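/- Let $m\ge 1$, $\lambda_d,\mu,P_d>0$, $\alpha_d>2$, $\sigma_d^2\ge 0$, $t\ge 0$, $\omega_d\in\mathbb R$ and $\delta_d^2\ge 0$. Base stations form a homogeneous Poisson point process $\{X_i\}$ on $\mathbb R$ with intensity $\lambda_d$, and the typical vehicle is at the origin. Station $i$ has a log-normal shadowing gain $\chi_i$, $10\log_{10}\chi_i\sim N(\omega_d,\delta_d^2)$, and is moved to $Y_i=\chi_i^{-1/\alpha_d}X_i$. Put $$\lambda_D=\mathbb E[\chi^{1/\alpha_d}]\,\lambda_d=\exp\Big(\frac{\omega_d\ln 10}{10\alpha_d}+\frac12\Big(\frac{\delta_d\ln 10}{10\alpha_d}\Big)^2\Big)\lambda_d .$$ Let $x_1<x_2<\cdots$ be the ordered distances $|Y_i|$. The $m$ nearest (moved) stations cooperate; their joint signal has a Rayleigh power gain $g$, common to the $m$ stations, and every other station $i$ interferes with its own Rayleigh power gain $g_i$. All of $g,g_1,g_2,\dots$ are exponential with rate $\mu$ (mean $1/\mu$), and $g$, the $g_i$, the $\chi_i$ and the process $\{X_i\}$ are independent. Let $$I_D=\sum_{i\ \text{not cooperating}}P_d\,g_i\,|Y_i|^{-\alpha_d},\qquad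 \mathrm{SINR}_D=\frac{\sum_{i=1}^m P_d\,g\,x_i^{-\alpha_d}}{I_D+\sigma_d^2}.$$ Then $I_D<\infty$ almost surely, and the coverage probability is $$\mathbb P(\mathrm{SINR}_D>t)=\int_{0<x_1<\cdots<x_m<\infty}\zeta_{I_D}(j)\,e^{-j\sigma_d^2}\,f(x_1,\dots,x_m)\,dx_1\cdots dx_m,\qquad j=\frac{\mu t}{\sum_{i=1}^m P_d x_i^{-\alpha_d}},$$ where the integrand is integrable, $f(x_1,\dots,x_m)=(2\lambda_D)^m e^{-2\lambda_D x_m}$ on $0<x_1<\cdots<x_m$ is the joint density of the $m$ smallest distances, and $\zeta_{I_D}(s)=\mathbb E[e^{-sI_D}\mid x_1,\dots,x_m]$ is the Laplace transform of the interference given these distances, which for almost every $(x_1,\dots,x_m)$ in this region and all $s\ge 0$ equals $$\zeta_{I_D}(s)=\exp\Big[-2\lambda_D\int_{x_m}^\infty\Big(1-\frac{\mu}{sP_dx^{-\alpha_d}+\mu}\Big)dx\Big].$$ -/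

import Mathlib

open MeasureTheory ProbabilityTheory
open scoped ENNReal NNReal

namespace CV2X

variable {Ω : Type*} [MeasurableSpace Ω]

/-- Number (possibly infinite) of points of the sequence `X` that lie in `A`. -/
noncomputable def count (X : ℕ → Ω → ℝ) (A : Set ℝ) (ω : Ω) : ℕ∞ :=
  {i : ℕ | X i ω ∈ A}.encard

/-- The points `X 0, X 1, …` (listed in an arbitrary way) form a homogeneous Poisson point process
on the real line with intensity `lam`. -/
structure IsPoissonProcess (P : Measure Ω) (lam : ℝ) (X : ℕ → Ω → ℝ) : Prop where
  measurable : ∀ i, Measurable (X i)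
  law : ∀ A : Set ℝ, MeasurableSet A → volume A < ∞ →
    HasLaw (count X A)
      ((poissonMeasure (lam * volume.real A).toNNReal).map (fun n : ℕ => (n : ℕ∞))) P
  indep : ∀ (n : ℕ) (A : Fin n → Set ℝ), (∀ k, MeasurableSet (A k)) →
    (∀ k l, k ≠ l → Disjoint (A k) (A l)) → iIndepFun (fun k => count X (A k)) P

/-- The random ingredients of the downlink seen from the typical vehicle at the origin:
* base stations `X i`, a Poisson process of intensity `lamd`;
* shadowing `chi i` of station `i`, i.i.d. log-normal, `10 log₁₀ (chi i) ∼ N(w, v)`;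
* Rayleigh power gain `G i` of station `i` when it interferes, i.i.d. exponential of rate `mu`;
* Rayleigh power gain `g` of the jointly transmitted useful signal, exponential of rate `mu`;
all of these being independent. -/
structure IsDownlink (P : Measure Ω) (lamd mu w : ℝ) (v : ℝ≥0)
    (X chi G : ℕ → Ω → ℝ) (g : Ω → ℝ) : Prop where
  poisson : IsPoissonProcess P lamd X
  chi_measurable : ∀ i, Measurable (chi i)
  chi_pos : ∀ i, ∀ᵐ ω ∂P, 0 < chi i ω
  chi_law : ∀ i, HasLaw (fun ω => 10 * Real.logb 10 (chi i ω)) (gaussianReal w v) P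
  chi_indep : iIndepFun chi P
  G_measurable : ∀ i, Measurable (G i)
  G_law : ∀ i, HasLaw (G i) (expMeasure mu) P
  G_indep : iIndepFun G P
  g_measurable : Measurable g
  g_law : HasLaw g (expMeasure mu) P
  indep_X : IndepFun (fun ω i => X i ω)
    (fun ω => ((fun i => chi i ω), (fun i => G i ω), g ω)) P
  indep_chi : IndepFun (fun ω i => chi i ω) (fun ω => ((fun i => G i ω), g ω)) P
  indep_G : IndepFun (fun ω i => G i ω) g P

/-- Displaced position `chi^(-1/alpha) x` of station `i`, which absorbs its shadowing. -/
noncomputable def displaced (alpha : ℝ) (X chi : ℕ → Ω → ℝ) (i : ℕ) (ω : Ω) : ℝ :=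
  chi i ω ^ (-(1 / alpha)) * X i ω

/-- Intensity of the displaced process, `lamD = E[chi^(1/alpha)] * lamd` in closed form. -/
noncomputable def lamD (lamd alpha w : ℝ) (v : ℝ≥0) : ℝ :=
  Real.exp (w * Real.log 10 / (10 * alpha)
    + (1 / 2) * (v : ℝ) * (Real.log 10 / (10 * alpha)) ^ 2) * lamd

/-- Distance from the origin to its `(k+1)`-st nearest point among `Y 0, Y 1, …`. -/
noncomputable def nthDist (Y : ℕ → Ω → ℝ) (k : ℕ) (ω : Ω) : ℝ :=
  sInf {r : ℝ | 0 ≤ r ∧ ((k + 1 : ℕ) : ℕ∞) ≤ {i : ℕ | |Y i ω| ≤ r}.encard}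

/-- The vector `(x_1, …, x_m)` of the `m` smallest distances. -/
noncomputable def dists (Y : ℕ → Ω → ℝ) (m : ℕ) (ω : Ω) : Fin m → ℝ :=
  fun k => nthDist Y k ω

/-- Indices of the cooperating stations: those with fewer than `m` strictly nearer stations. -/
def cooperating (Y : ℕ → Ω → ℝ) (m : ℕ) (ω : Ω) : Set ℕ :=
  {i | {k : ℕ | |Y k ω| < |Y i ω|}.encard < (m : ℕ∞)}

/-- Aggregate interference from all stations outside the cooperating set, as an extended
nonnegative number. -/
noncomputable def interference (Pd alpha : ℝ) (Y G : ℕ → Ω → ℝ) (m : ℕ) (ω : Ω) : ℝ≥0∞ :=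
  ∑' i : ((cooperating Y m ω)ᶜ : Set ℕ), ENNReal.ofReal (Pd * G i ω * |Y i ω| ^ (-alpha))

/-- The downlink SINR with `m` cooperating stations and noise power `sig2`. -/
noncomputable def sinr (Pd alpha sig2 : ℝ) (Y G : ℕ → Ω → ℝ) (g : Ω → ℝ) (m : ℕ) (ω : Ω) :
    ℝ≥0∞ :=
  ENNReal.ofReal (∑ k : Fin m, Pd * g ω * dists Y m ω k ^ (-alpha)) /
    (interference Pd alpha Y G m ω + ENNReal.ofReal sig2)

/-- The region `0 < x_1 < ⋯ < x_m`. -/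
def orderedRegion (m : ℕ) : Set (Fin m → ℝ) :=
  {x | (∀ k, 0 < x k) ∧ StrictMono x}

/-- The joint distance density, `r` being the largest of the `m` distances. -/
noncomputable def jointDensity (lam : ℝ) (m : ℕ) (r : ℝ) : ℝ :=
  (2 * lam) ^ m * Real.exp (-(2 * lam * r))

/-- The argument `mu t / ∑ Pd x_i^(-alpha)`. -/
noncomputable def jArg (mu t Pd alpha : ℝ) {m : ℕ} (x : Fin m → ℝ) : ℝ :=
  mu * t / ∑ k, Pd * x k ^ (-alpha)

/-- Closed form of the Laplace transform at `s` of the interference from beyond distance `r`. -/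
noncomputable def zeta (lam mu Pd alpha s r : ℝ) : ℝ :=
  Real.exp (-(2 * lam * ∫ x in Set.Ioi r, (1 - mu / (s * Pd * x ^ (-alpha) + mu))))

end CV2X

/-! Given the distances and the interference `I`, coverage means that the independent exponential
gain `g` exceeds `t (I + sig2) / ∑ Pd x_k^(-alpha)`, which has probability `exp (-j I) exp (-j
sig2)`. Averaging over `I` given the distances, and then over the distances, leaves the conditional
Laplace transform of `I` integrated against the joint density. So what is needed is the joint law of
the nearest distances and of the points beyond them.

Point processes are handled through Laplace functionals `E exp (-∑ h)` with `h` valued in `[0, ∞]`;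
the value `∞` on a set expresses that the set contains no points. Poisson counts on disjoint sets
give the functional of the stations (`IsPoissonProcess.lintegral_expNeg`). Independent marks are
integrated out one family at a time (`lintegral_expNeg_marks`), and the line is folded by `|·|`. The
result is `IsRadialPoisson`: the marked distances form a Poisson process of rate `2 lamD` on the
half-line. The factor `E[chi^(1/alpha)]` in `lamD` is the averaged Jacobian of the displacement.
Positivity, local finiteness and distinctness of the distances then follow almost surely from the
functional alone.

The core is `HasTailLaw`: the `k` smallest distances have density `L^k exp (-L x_k)` on the ordered
region, and given them the points beyond `x_k` are still Poisson. It is proved by induction on `k`.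
Applying the case `k` to two functionals, one forbidding further points up to `c` and the other up
to `c'`, and subtracting, isolates the event that the next distance lies in `(c, c']`, together with
the points beyond `c'`. Refining a grid of such cells (`setLIntegral_eq_of_grid`) moves the tail
from `c'` to the next distance itself.

Taking for `h` the path loss times `s` gives `zeta`; the case `s = 0` gives the law of the
distances, and `s → 0` the finiteness of `I`. Rational `s` and continuity give a null set of
distance vectors that serves all `s ≥ 0`. -/

namespace CV2X

open Filter Topology Set

/-! ### The function `x ↦ exp (-x)` on `[0, ∞]` -/

/-- The function `x ↦ exp (-x)` on `[0, ∞]`, with value `0` at `∞`. -/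
noncomputable def expNeg (x : ℝ≥0∞) : ℝ≥0∞ := EReal.exp (-(x : EReal))

@[simp] lemma expNeg_zero : expNeg 0 = 1 := by simp [expNeg]

@[simp] lemma expNeg_top : expNeg ∞ = 0 := by simp [expNeg]

lemma continuous_expNeg : Continuous expNeg :=
  ENNReal.continuous_exp.comp (continuous_neg.comp continuous_coe_ennreal_ereal)

lemma measurable_expNeg : Measurable expNeg := continuous_expNeg.measurable

lemma antitone_expNeg : Antitone expNeg := fun a b h =>
  EReal.exp_monotone (EReal.neg_le_neg_iff.2 (by exact_mod_cast h))

lemma expNeg_le_one (x : ℝ≥0∞) : expNeg x ≤ 1 := by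
  simpa using antitone_expNeg (zero_le (a := x))

lemma expNeg_ne_top (x : ℝ≥0∞) : expNeg x ≠ ∞ :=
  ne_top_of_le_ne_top ENNReal.one_ne_top (expNeg_le_one x)

lemma expNeg_ofReal {x : ℝ} (hx : 0 ≤ x) :
    expNeg (ENNReal.ofReal x) = ENNReal.ofReal (Real.exp (-x)) := by
  rw [expNeg, EReal.coe_ennreal_ofReal, max_eq_left hx, ← EReal.coe_neg, EReal.exp_coe]

lemma expNeg_add (x y : ℝ≥0∞) : expNeg (x + y) = expNeg x * expNeg y := by
  rw [expNeg, expNeg, expNeg, ← EReal.exp_add, EReal.coe_ennreal_add,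
    EReal.neg_add (Or.inl (by simp)) (Or.inr (by simp)), sub_eq_add_neg]

lemma expNeg_sum {ι : Type*} (s : Finset ι) (f : ι → ℝ≥0∞) :
    expNeg (∑ i ∈ s, f i) = ∏ i ∈ s, expNeg (f i) := by
  classical
  induction s using Finset.induction_on with
  | empty => simp
  | insert a s ha ih => rw [Finset.sum_insert ha, Finset.prod_insert ha, expNeg_add, ih]

lemma expNeg_mul_nat (x : ℝ≥0∞) (n : ℕ) : expNeg (x * n) = expNeg x ^ n := by
  induction n with
  | zero => simp
  | succ n ih => rw [Nat.cast_succ, mul_add, mul_one, expNeg_add, ih, pow_succ]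

/-- The inverse of `expNeg` on `[0, 1]`. -/
noncomputable def negLog (y : ℝ≥0∞) : ℝ≥0∞ := (-(ENNReal.log y)).toENNReal

lemma measurable_negLog : Measurable negLog :=
  measurable_ereal_toENNReal.comp (measurable_neg.comp ENNReal.measurable_log)

lemma expNeg_negLog {y : ℝ≥0∞} (hy : y ≤ 1) : expNeg (negLog y) = y := by
  have h : ENNReal.log y ≤ 0 := by
    rw [← ENNReal.log_one]
    exact ENNReal.log_monotone hy
  rw [expNeg, negLog, EReal.coe_toENNReal (EReal.le_neg_of_le_neg (by simpa using h)), neg_neg,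
    ENNReal.exp_log]

lemma tendsto_tsum_of_monotone {f : ℕ → ℕ → ℝ≥0∞} {g : ℕ → ℝ≥0∞}
    (hmono : ∀ i, Monotone fun n => f n i) (hlim : ∀ i, Tendsto (fun n => f n i) atTop (𝓝 (g i))) :
    Tendsto (fun n => ∑' i, f n i) atTop (𝓝 (∑' i, g i)) := by
  simp_rw [← lintegral_count]
  exact lintegral_tendsto_of_tendsto_of_monotone (fun n => Measurable.of_discrete.aemeasurable)
    (ae_of_all _ hmono) (ae_of_all _ hlim)

lemma tendsto_lintegral_expNeg {α : Type*} [MeasurableSpace α] {μ : Measure α} [IsFiniteMeasure μ]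
    {f : ℕ → α → ℝ≥0∞} {g : α → ℝ≥0∞} (hf : ∀ n, Measurable (f n))
    (hlim : ∀ x, Tendsto (fun n => f n x) atTop (𝓝 (g x))) :
    Tendsto (fun n => ∫⁻ x, expNeg (f n x) ∂μ) atTop (𝓝 (∫⁻ x, expNeg (g x) ∂μ)) := by
  refine tendsto_lintegral_of_dominated_convergence (fun _ => 1)
    (fun n => measurable_expNeg.comp (hf n)) (fun n => ae_of_all _ fun x => expNeg_le_one _)
    (by simp) (ae_of_all _ fun x => (continuous_expNeg.tendsto _).comp (hlim x))

/-! ### The Laplace functional of a Poisson process -/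

lemma measurable_encard {Ω : Type*} [MeasurableSpace Ω] {p : ℕ → Ω → Prop}
    (hp : ∀ i, MeasurableSet {ω | p i ω}) : Measurable fun ω => {i | p i ω}.encard := by
  classical
  have h : ∀ ω, (({i | p i ω}.encard : ℕ∞) : ℝ≥0∞)
      = ∑' i, {ω | p i ω}.indicator (fun _ => (1 : ℝ≥0∞)) ω := by
    intro ω
    rw [← ENNReal.tsum_set_one, tsum_subtype {i | p i ω} (fun _ => (1 : ℝ≥0∞))]
    rfl
  have hm : Measurable fun ω => (({i | p i ω}.encard : ℕ∞) : ℝ≥0∞) := by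
    simp_rw [h]
    exact Measurable.tsum fun i => measurable_const.indicator (hp i)
  rw [ENat.measurable_iff]
  intro n
  have : (fun ω => {i | p i ω}.encard) ⁻¹' {(n : ℕ∞)}
      = (fun ω => (({i | p i ω}.encard : ℕ∞) : ℝ≥0∞)) ⁻¹' {(n : ℝ≥0∞)} := by
    ext ω
    simp only [mem_preimage, mem_singleton_iff]
    rw [← ENat.toENNReal_coe, ENat.toENNReal_inj]
  rw [this]
  exact hm (measurableSet_singleton _)

/-- This is the Poisson generating function `E z^N = exp (-θ (1 - z))` at `z = exp (-y)`. For `y =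
∞` the convention `0 ^ 0 = 1` makes it the probability that `N = 0`. -/
lemma lintegral_expNeg_of_poisson {Ω : Type*} [MeasurableSpace Ω] {P : Measure Ω} {θ : ℝ≥0}
    {N : Ω → ℕ∞} (hN : HasLaw N ((poissonMeasure θ).map (fun n : ℕ => (n : ℕ∞))) P) (y : ℝ≥0∞) :
    ∫⁻ ω, expNeg (y * (N ω : ℝ≥0∞)) ∂P = expNeg (θ * (1 - expNeg y)) := by
  have h1 : ∫⁻ ω, expNeg (y * (N ω : ℝ≥0∞)) ∂P
      = ∫⁻ n, expNeg (y * ((n : ℕ∞) : ℝ≥0∞)) ∂(P.map N) :=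
    (lintegral_map' (f := fun n : ℕ∞ => expNeg (y * (n : ℝ≥0∞)))
      Measurable.of_discrete.aemeasurable hN.aemeasurable).symm
  set z : ℝ := (expNeg y).toReal with hz
  have hz0 : 0 ≤ z := ENNReal.toReal_nonneg
  have hz1 : z ≤ 1 := by
    have := ENNReal.toReal_mono ENNReal.one_ne_top (expNeg_le_one y)
    simpa using this
  have hzy : expNeg y = ENNReal.ofReal z := (ENNReal.ofReal_toReal (expNeg_ne_top y)).symm
  rw [h1, hN.map_eq, lintegral_map Measurable.of_discrete Measurable.of_discrete, poissonMeasure,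
    lintegral_sum_measure]
  have h2 : ∀ n : ℕ, ∫⁻ a : ℕ, expNeg (y * ((a : ℕ∞) : ℝ≥0∞))
      ∂(ENNReal.ofReal (Real.exp (-θ) * θ ^ n / n.factorial) • Measure.dirac n)
      = ENNReal.ofReal (Real.exp (-θ) * ((θ * z) ^ n / n.factorial)) := by
    intro n
    rw [lintegral_smul_measure, lintegral_dirac, ENat.toENNReal_coe, expNeg_mul_nat, hzy,
      ← ENNReal.ofReal_pow hz0, smul_eq_mul, ← ENNReal.ofReal_mul (by positivity)]
    congr 1
    ring
  have h3 : HasSum (fun n : ℕ => Real.exp (-θ) * ((θ * z) ^ n / n.factorial))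
      (Real.exp (-θ) * Real.exp (θ * z)) := by
    have := (NormedSpace.expSeries_div_hasSum_exp ((θ : ℝ) * z)).mul_left (Real.exp (-θ))
    rwa [← Real.exp_eq_exp_ℝ] at this
  simp_rw [h2]
  rw [← ENNReal.ofReal_tsum_of_nonneg (fun n => by positivity) h3.summable, h3.tsum_eq, hzy,
    ← ENNReal.ofReal_one, ← ENNReal.ofReal_sub _ hz0, ← ENNReal.ofReal_coe_nnreal,
    ← ENNReal.ofReal_mul (by positivity), expNeg_ofReal (mul_nonneg θ.coe_nonneg (by linarith)),
    ← Real.exp_add]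
  congr 2
  ring

/-- The value `0` is left out because its fibre may have infinite volume, where
`IsPoissonProcess.law` gives no information on the count. -/
lemma simpleFunc_tsum_eq {X : ℕ → ℝ} (s : SimpleFunc ℝ ℝ≥0∞) :
    ∑' i, s (X i) = ∑ y ∈ s.range.filter (· ≠ 0), y * (({i | X i ∈ s ⁻¹' {y}}.encard : ℕ∞) : ℝ≥0∞) := by
  classical
  have h : ∀ x, s x = ∑ y ∈ s.range.filter (· ≠ 0), y * (s ⁻¹' {y}).indicator (fun _ => 1) x := by
    intro x
    rw [Finset.sum_filter, Finset.sum_eq_single (s x)]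
    · by_cases h0 : s x = 0 <;> simp [h0]
    · intro y _ hy
      have : x ∉ s ⁻¹' {y} := fun h => hy h.symm
      simp [this]
    · intro h
      exact absurd (s.mem_range_self x) h
  have h2 : ∀ y : ℝ≥0∞, (({i | X i ∈ s ⁻¹' {y}}.encard : ℕ∞) : ℝ≥0∞)
      = ∑' i, (s ⁻¹' {y}).indicator (fun _ => (1 : ℝ≥0∞)) (X i) := by
    intro y
    rw [← ENNReal.tsum_set_one, tsum_subtype {i | X i ∈ s ⁻¹' {y}} (fun _ => (1 : ℝ≥0∞))]
    rfl
  conv_lhs => enter [1, i]; rw [h]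
  rw [Summable.tsum_finsetSum fun _ _ => ENNReal.summable]
  simp_rw [ENNReal.tsum_mul_left, h2]

/-- Counts on the disjoint fibres are independent, so the expectation factors into Poisson
generating functions, whose exponents add up to the integral. -/
lemma IsPoissonProcess.lintegral_expNeg_simpleFunc {Ω : Type*} [MeasurableSpace Ω] {P : Measure Ω}
    {lam : ℝ} {X : ℕ → Ω → ℝ} (hX : IsPoissonProcess P lam X) (hlam : 0 ≤ lam)
    (s : SimpleFunc ℝ ℝ≥0∞) (hs : ∀ y ≠ 0, volume (s ⁻¹' {y}) < ∞) :
    ∫⁻ ω, expNeg (∑' i, s (X i ω)) ∂P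
      = expNeg (ENNReal.ofReal lam * ∫⁻ x, (1 - expNeg (s x))) := by
  classical
  set R := s.range.filter (· ≠ 0) with hR
  let e := R.equivFin.symm
  let A : Fin R.card → Set ℝ := fun k => s ⁻¹' {(e k : ℝ≥0∞)}
  have hA : ∀ k, MeasurableSet (A k) := fun k => s.measurableSet_fiber _
  have hdisj : ∀ k l, k ≠ l → Disjoint (A k) (A l) := by
    intro k l hkl
    refine Disjoint.preimage _ (disjoint_singleton.2 fun h => hkl ?_)
    exact e.injective (Subtype.ext h)
  have hcm : ∀ k, Measurable (count X (A k)) := fun k =>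
    measurable_encard fun i => hX.measurable i (hA k)
  have hind := (hX.indep _ A hA hdisj).comp (fun k (n : ℕ∞) => expNeg ((e k : ℝ≥0∞) * (n : ℝ≥0∞)))
    (fun k => Measurable.of_discrete)
  have hreind : ∀ F : ℝ≥0∞ → ℝ≥0∞, ∏ y ∈ R, F y = ∏ k, F (e k) := by
    intro F
    rw [← Finset.prod_coe_sort R F]
    exact (Equiv.prod_comp e (fun y : R => F y)).symm
  have h1 : ∀ ω, expNeg (∑' i, s (X i ω))
      = ∏ k, expNeg ((e k : ℝ≥0∞) * (count X (A k) ω : ℝ≥0∞)) := by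
    intro ω
    rw [simpleFunc_tsum_eq, expNeg_sum, hreind]
    rfl
  simp_rw [h1]
  have h2 := lintegral_prod_eq_prod_lintegral_of_indepFun (μ := P) Finset.univ _ hind
    (fun k => (Measurable.of_discrete (f := fun n : ℕ∞ =>
      expNeg ((e k : ℝ≥0∞) * (n : ℝ≥0∞)))).comp (hcm k))
  simp only [Function.comp_def] at h2
  rw [h2]
  have h3 : ∀ k, ∫⁻ ω, expNeg ((e k : ℝ≥0∞) * (count X (A k) ω : ℝ≥0∞)) ∂P
      = expNeg (ENNReal.ofReal lam * ((1 - expNeg (e k)) * volume (A k))) := by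
    intro k
    have hk : volume (A k) < ∞ := hs _ (Finset.mem_filter.1 (e k).2).2
    rw [lintegral_expNeg_of_poisson (hX.law (A k) (hA k) hk)]
    congr 1
    have : (((lam * volume.real (A k)).toNNReal : ℝ≥0) : ℝ≥0∞)
        = ENNReal.ofReal lam * volume (A k) := by
      change ENNReal.ofReal (lam * volume.real (A k)) = _
      rw [ENNReal.ofReal_mul hlam, measureReal_def, ENNReal.ofReal_toReal hk.ne]
    rw [this]
    ring
  simp_rw [h3]
  rw [← expNeg_sum, ← Finset.mul_sum]
  congr 2
  have h4 : ∫⁻ x, (1 - expNeg (s x)) = (s.map fun y => 1 - expNeg y).lintegral volume := by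
    rw [← SimpleFunc.lintegral_eq_lintegral]
    rfl
  rw [h4, SimpleFunc.map_lintegral]
  have h5 : ∑ y ∈ s.range, (1 - expNeg y) * volume (s ⁻¹' {y})
      = ∑ y ∈ R, (1 - expNeg y) * volume (s ⁻¹' {y}) := by
    rw [hR, Finset.sum_filter]
    refine Finset.sum_congr rfl fun y _ => ?_
    by_cases h0 : y = 0 <;> simp [h0]
  rw [h5, ← Finset.sum_coe_sort R]
  exact (Equiv.sum_comp e (fun y : R => (1 - expNeg y) * volume (s ⁻¹' {(y : ℝ≥0∞)})))

theorem IsPoissonProcess.lintegral_expNeg {Ω : Type*} [MeasurableSpace Ω] {P : Measure Ω}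
    [IsProbabilityMeasure P] {lam : ℝ} {X : ℕ → Ω → ℝ} (hX : IsPoissonProcess P lam X)
    (hlam : 0 ≤ lam) {ψ : ℝ → ℝ≥0∞} (hψ : Measurable ψ) :
    ∫⁻ ω, expNeg (∑' i, ψ (X i ω)) ∂P
      = expNeg (ENNReal.ofReal lam * ∫⁻ x, (1 - expNeg (ψ x))) := by
  -- Truncation to `[-n, n]` gives the nonzero fibres finite volume and keeps the sequence
  -- increasing to `ψ`.
  let s : ℕ → SimpleFunc ℝ ℝ≥0∞ := fun n => (SimpleFunc.eapprox ψ n).restrict (Icc (-n : ℝ) n)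
  have hsapp : ∀ n x, s n x = (Icc (-n : ℝ) n).indicator (SimpleFunc.eapprox ψ n) x := fun n x => by
    simp only [s]
    rw [SimpleFunc.restrict_apply _ measurableSet_Icc]
  have hmono : ∀ x, Monotone fun n => s n x := by
    intro x n n' hn
    simp only [hsapp]
    have hc : (n : ℝ) ≤ n' := by exact_mod_cast hn
    refine (indicator_le_indicator (SimpleFunc.monotone_eapprox ψ hn x)).trans
      (indicator_le_indicator_of_subset (Icc_subset_Icc (by linarith) hc) (fun _ => zero_le) x)
  have hlim : ∀ x, Tendsto (fun n => s n x) atTop (𝓝 (ψ x)) := by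
    intro x
    have h1 : Tendsto (fun n => SimpleFunc.eapprox ψ n x) atTop (𝓝 (ψ x)) := by
      rw [← SimpleFunc.iSup_eapprox_apply hψ x]
      exact tendsto_atTop_iSup fun n n' h => SimpleFunc.monotone_eapprox ψ h x
    refine h1.congr' ?_
    filter_upwards [eventually_ge_atTop ⌈|x|⌉₊] with n hn
    have hx : |x| ≤ n := (Nat.le_ceil _).trans (by exact_mod_cast hn)
    rw [hsapp, indicator_of_mem (show x ∈ Icc (-n : ℝ) n from abs_le.1 hx)]
  have hfin : ∀ n, ∀ y ≠ 0, volume (s n ⁻¹' {y}) < ∞ := by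
    intro n y hy
    refine (measure_mono (t := Icc (-n : ℝ) n) fun x hx => ?_).trans_lt measure_Icc_lt_top
    by_contra hxn
    apply hy
    rw [← (show s n x = y from hx), hsapp, indicator_of_notMem hxn]
  have hL : Tendsto (fun n => ∫⁻ ω, expNeg (∑' i, s n (X i ω)) ∂P) atTop
      (𝓝 (∫⁻ ω, expNeg (∑' i, ψ (X i ω)) ∂P)) :=
    tendsto_lintegral_expNeg
      (fun n => Measurable.tsum fun i => (s n).measurable.comp (hX.measurable i))
      (fun ω => tendsto_tsum_of_monotone (fun i => hmono _) (fun i => hlim _))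
  have hI : Tendsto (fun n => ∫⁻ x, (1 - expNeg (s n x))) atTop
      (𝓝 (∫⁻ x, (1 - expNeg (ψ x)))) := by
    refine lintegral_tendsto_of_tendsto_of_monotone
      (fun n => (measurable_const.sub (measurable_expNeg.comp (s n).measurable)).aemeasurable)
      (ae_of_all _ fun x n n' h => tsub_le_tsub_left (antitone_expNeg (hmono x h)) _)
      (ae_of_all _ fun x => ?_)
    exact ENNReal.Tendsto.sub tendsto_const_nhds ((continuous_expNeg.tendsto _).comp (hlim x))
      (Or.inl ENNReal.one_ne_top)
  have hR : Tendsto (fun n => expNeg (ENNReal.ofReal lam * ∫⁻ x, (1 - expNeg (s n x)))) atTop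
      (𝓝 (expNeg (ENNReal.ofReal lam * ∫⁻ x, (1 - expNeg (ψ x))))) :=
    (continuous_expNeg.tendsto _).comp
      (ENNReal.Tendsto.const_mul hI (Or.inr ENNReal.ofReal_ne_top))
  refine tendsto_nhds_unique hL (hR.congr fun n => ?_)
  exact (hX.lintegral_expNeg_simpleFunc hlam (s n) (hfin n)).symm

/-! ### Independent marks -/

/-- The independence hypotheses of `IsDownlink` are nested to the right; this regroups them. Both
sides are the same triple product law up to associativity. -/
lemma indepFun_prodMk_left {Ω α β γ : Type*} [MeasurableSpace Ω] [MeasurableSpace α]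
    [MeasurableSpace β] [MeasurableSpace γ] {P : Measure Ω} [IsProbabilityMeasure P]
    {A : Ω → α} {B : Ω → β} {C : Ω → γ} (hA : Measurable A) (hB : Measurable B)
    (hC : Measurable C) (h1 : IndepFun A (fun ω => (B ω, C ω)) P) (h2 : IndepFun B C P) :
    IndepFun (fun ω => (A ω, B ω)) C P := by
  have := Measure.isProbabilityMeasure_map (μ := P) hA.aemeasurable
  have := Measure.isProbabilityMeasure_map (μ := P) hB.aemeasurable
  have := Measure.isProbabilityMeasure_map (μ := P) hC.aemeasurable
  have hAB : IndepFun A B P := h1.comp measurable_id measurable_fst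
  rw [indepFun_iff_map_prod_eq_prod_map_map hA.aemeasurable (hB.prodMk hC).aemeasurable] at h1
  rw [indepFun_iff_map_prod_eq_prod_map_map hB.aemeasurable hC.aemeasurable] at h2
  rw [indepFun_iff_map_prod_eq_prod_map_map hA.aemeasurable hB.aemeasurable] at hAB
  rw [indepFun_iff_map_prod_eq_prod_map_map (hA.prodMk hB).aemeasurable hC.aemeasurable, hAB]
  apply (MeasurableEquiv.prodAssoc (α := α) (β := β) (γ := γ)).map_measurableEquiv_injective
  rw [Measure.prodAssoc_prod, ← h2, ← h1,
    Measure.map_map MeasurableEquiv.prodAssoc.measurable ((hA.prodMk hB).prodMk hC)]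
  rfl

/-- Integrating out i.i.d. marks `V i` attached to an independent sequence `U`. -/
theorem lintegral_expNeg_marks {Ω E F : Type*} [MeasurableSpace Ω] [MeasurableSpace E]
    [MeasurableSpace F] {P : Measure Ω} [IsProbabilityMeasure P] {ρ : Measure F}
    [IsProbabilityMeasure ρ] {U : ℕ → Ω → E} {V : ℕ → Ω → F} (hU : ∀ i, Measurable (U i))
    (hV : ∀ i, Measurable (V i)) (hlaw : ∀ i, P.map (V i) = ρ) (hind : iIndepFun V P)
    (hUV : IndepFun (fun ω i => U i ω) (fun ω i => V i ω) P) {Ψ : E × F → ℝ≥0∞}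
    (hΨ : Measurable Ψ) :
    ∫⁻ ω, expNeg (∑' i, Ψ (U i ω, V i ω)) ∂P
      = ∫⁻ ω, expNeg (∑' i, negLog (∫⁻ v, expNeg (Ψ (U i ω, v)) ∂ρ)) ∂P := by
  have hUm : Measurable fun ω i => U i ω := measurable_pi_lambda _ hU
  have hVm : Measurable fun ω i => V i ω := measurable_pi_lambda _ hV
  have := Measure.isProbabilityMeasure_map (μ := P) hUm.aemeasurable
  have := Measure.isProbabilityMeasure_map (μ := P) hVm.aemeasurable
  set φ : E → ℝ≥0∞ := fun u => ∫⁻ v, expNeg (Ψ (u, v)) ∂ρ with hφdef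
  have hφ : Measurable φ := (measurable_expNeg.comp hΨ).lintegral_prod_right'
  have hφ1 : ∀ u, φ u ≤ 1 := fun u =>
    (lintegral_mono fun v => expNeg_le_one _).trans (by simp)
  -- With finitely many marks, Fubini freezes `U` and independence factors the inner integral.
  -- Writing each factor as `expNeg (negLog _)` restores the form of a Laplace functional, so that
  -- the procedure can be iterated; `n → ∞` then follows by dominated convergence.
  have hfin : ∀ n : ℕ, ∫⁻ ω, expNeg (∑ i ∈ Finset.range n, Ψ (U i ω, V i ω)) ∂P
      = ∫⁻ ω, expNeg (∑ i ∈ Finset.range n, negLog (φ (U i ω))) ∂P := by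
    intro n
    have hm : Measurable fun p : (ℕ → E) × (ℕ → F) =>
        expNeg (∑ i ∈ Finset.range n, Ψ (p.1 i, p.2 i)) := by
      refine measurable_expNeg.comp (Finset.measurable_sum _ fun i _ => hΨ.comp ?_)
      exact ((measurable_pi_apply i).comp measurable_fst).prodMk
        ((measurable_pi_apply i).comp measurable_snd)
    have hm2 : Measurable fun u : ℕ → E => expNeg (∑ i ∈ Finset.range n, negLog (φ (u i))) :=
      measurable_expNeg.comp (Finset.measurable_sum _ fun i _ =>
        measurable_negLog.comp (hφ.comp (measurable_pi_apply i)))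
    have e1 := lintegral_map (μ := P) hm (hUm.prodMk hVm)
    rw [(indepFun_iff_map_prod_eq_prod_map_map hUm.aemeasurable hVm.aemeasurable).1 hUV,
      lintegral_prod _ hm.aemeasurable] at e1
    have e2 := lintegral_map (μ := P) hm2 hUm
    rw [← e1, ← e2]
    refine lintegral_congr fun u => ?_
    have hmu : Measurable fun v : ℕ → F => expNeg (∑ i ∈ Finset.range n, Ψ (u i, v i)) :=
      hm.comp measurable_prodMk_left
    rw [lintegral_map hmu hVm]
    simp_rw [expNeg_sum]
    have hg : ∀ i, Measurable fun v => expNeg (Ψ (u i, v)) := fun i =>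
      measurable_expNeg.comp (hΨ.comp measurable_prodMk_left)
    have e3 := lintegral_prod_eq_prod_lintegral_of_indepFun (μ := P) (Finset.range n) _
      (hind.comp (fun i v => expNeg (Ψ (u i, v))) hg) (fun i => (hg i).comp (hV i))
    simp only [Function.comp_def] at e3
    rw [e3]
    refine Finset.prod_congr rfl fun i _ => ?_
    rw [expNeg_negLog (hφ1 _), ← lintegral_map (hg i) (hV i), hlaw i]
  have hL := tendsto_lintegral_expNeg (μ := P)
    (f := fun n ω => ∑ i ∈ Finset.range n, Ψ (U i ω, V i ω))
    (fun n => Finset.measurable_sum _ fun i _ => hΨ.comp ((hU i).prodMk (hV i)))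
    (fun ω => ENNReal.tendsto_nat_tsum _)
  have hR := tendsto_lintegral_expNeg (μ := P)
    (f := fun n ω => ∑ i ∈ Finset.range n, negLog (φ (U i ω)))
    (fun n => Finset.measurable_sum _ fun i _ => measurable_negLog.comp (hφ.comp (hU i)))
    (fun ω => ENNReal.tendsto_nat_tsum _)
  exact tendsto_nhds_unique hL (hR.congr fun n => (hfin n).symm)

/-! ### The displaced process -/

/-- The law of the shadowing gain. -/
noncomputable def shadowing (w : ℝ) (v : ℝ≥0) : Measure ℝ :=
  (gaussianReal w v).map fun n => Real.exp (Real.log 10 / 10 * n)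

instance (w : ℝ) (v : ℝ≥0) : IsProbabilityMeasure (shadowing w v) :=
  Measure.isProbabilityMeasure_map (by fun_prop)

/-- The logarithm cannot see the sign of its argument, so recovering `chi` from its decibel value
uses almost sure positivity. -/
lemma IsDownlink.map_chi {Ω : Type*} [MeasurableSpace Ω] {P : Measure Ω} {lamd mu w : ℝ} {v : ℝ≥0}
    {X chi G : ℕ → Ω → ℝ} {g : Ω → ℝ} (h : IsDownlink P lamd mu w v X chi G g) (i : ℕ) :
    P.map (chi i) = shadowing w v := by
  rw [shadowing, ← (h.chi_law i).map_eq,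
    AEMeasurable.map_map_of_aemeasurable (by fun_prop) (h.chi_law i).aemeasurable]
  refine Measure.map_congr ?_
  filter_upwards [h.chi_pos i] with ω hω
  have h10 : Real.log 10 ≠ 0 := (Real.log_pos (by norm_num)).ne'
  have : Real.log 10 / 10 * (10 * Real.logb 10 (chi i ω)) = Real.log (chi i ω) := by
    rw [Real.logb]
    field_simp
  simp only [Function.comp_apply]
  rw [this, Real.exp_log hω]

lemma ae_shadowing_pos (w : ℝ) (v : ℝ≥0) : ∀ᵐ c ∂shadowing w v, 0 < c := by
  rw [shadowing, ae_map_iff (by fun_prop) measurableSet_Ioi]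
  exact ae_of_all _ fun x => Real.exp_pos _

/-- A log-normal moment is a value of the Gaussian moment generating function. -/
lemma lintegral_shadowing_rpow (w a : ℝ) (v : ℝ≥0) :
    ∫⁻ c, ENNReal.ofReal (c ^ a) ∂shadowing w v
      = ENNReal.ofReal (Real.exp (w * (Real.log 10 / 10 * a)
        + v * (Real.log 10 / 10 * a) ^ 2 / 2)) := by
  have h : ∀ x : ℝ, Real.exp (Real.log 10 / 10 * x) ^ a = Real.exp (Real.log 10 / 10 * a * x) := by
    intro x
    rw [← Real.exp_mul]
    congr 1
    ring
  rw [shadowing, lintegral_map (by fun_prop) (by fun_prop)]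
  simp_rw [h]
  rw [← ofReal_integral_eq_lintegral_ofReal (integrable_exp_mul_gaussianReal _)
    (ae_of_all _ fun x => (Real.exp_pos _).le)]
  have := congrFun (mgf_id_gaussianReal (μ := w) (v := v)) (Real.log 10 / 10 * a)
  rw [← this]
  rfl

lemma lintegral_comp_abs {f : ℝ → ℝ≥0∞} (hf : Measurable f) :
    ∫⁻ x, f |x| = 2 * ∫⁻ x in Ioi 0, f x := by
  have h1 : ∫⁻ x in Ioi 0, f |x| = ∫⁻ x in Ioi 0, f x :=
    setLIntegral_congr_fun measurableSet_Ioi fun x hx => by rw [abs_of_pos hx]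
  have h2 : ∫⁻ x in Iio 0, f |x| = ∫⁻ x in Ioi 0, f x := by
    have := (Measure.measurePreserving_neg (volume : Measure ℝ)).setLIntegral_comp_preimage
      (measurableSet_Ioi (a := (0 : ℝ))) hf
    rw [← this]
    have hs : Neg.neg ⁻¹' Ioi (0 : ℝ) = Iio 0 := by ext; simp
    rw [hs]
    exact setLIntegral_congr_fun measurableSet_Iio fun x hx => by rw [abs_of_neg hx]
  have h3 : ∫⁻ x in Iic 0, f |x| = ∫⁻ x in Iio 0, f |x| :=
    setLIntegral_congr Iio_ae_eq_Iic.symm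
  rw [← lintegral_add_compl _ (measurableSet_Ioi (a := (0 : ℝ))), compl_Ioi, h1, h3, h2, two_mul]

lemma lintegral_comp_abs_mul {f : ℝ → ℝ≥0∞} (hf : Measurable f) {a : ℝ} (ha : 0 < a) :
    ∫⁻ x, f |a * x| = ENNReal.ofReal a⁻¹ * (2 * ∫⁻ x in Ioi 0, f x) := by
  rw [← lintegral_comp_abs hf]
  have := lintegral_map (μ := volume) (f := fun x => f |x|) (hf.comp (by fun_prop))
    (measurable_const_mul a)
  rw [← this, Real.map_volume_mul_left ha.ne', lintegral_smul_measure, abs_of_pos (inv_pos.2 ha),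
    smul_eq_mul]

/-- The distances `|Y i|`, marked by `G i`, form a Poisson process on `(0, ∞) × ℝ` with intensity
`L dr ⊗ ρ`, expressed through the Laplace functional. -/
structure IsRadialPoisson {Ω : Type*} [MeasurableSpace Ω] (P : Measure Ω) (L : ℝ) (ρ : Measure ℝ)
    (Y G : ℕ → Ω → ℝ) : Prop where
  measurable_Y : ∀ i, Measurable (Y i)
  measurable_G : ∀ i, Measurable (G i)
  laplace : ∀ h : ℝ × ℝ → ℝ≥0∞, Measurable h →
    ∫⁻ ω, expNeg (∑' i, h (|Y i ω|, G i ω)) ∂P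
      = expNeg (ENNReal.ofReal L * ∫⁻ r in Ioi 0, (1 - ∫⁻ x, expNeg (h (r, x)) ∂ρ))

lemma measurable_displaced {Ω : Type*} [MeasurableSpace Ω] {X chi : ℕ → Ω → ℝ}
    (hX : ∀ i, Measurable (X i)) (hchi : ∀ i, Measurable (chi i)) (alpha : ℝ) (i : ℕ) :
    Measurable (displaced alpha X chi i) :=
  ((hchi i).pow_const _).mul (hX i)

lemma lamD_pos {lamd alpha w : ℝ} {v : ℝ≥0} (h : 0 < lamd) : 0 < lamD lamd alpha w v :=
  mul_pos (Real.exp_pos _) h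

theorem IsDownlink.isRadialPoisson {Ω : Type*} [MeasurableSpace Ω] {P : Measure Ω}
    [IsProbabilityMeasure P] {lamd mu w : ℝ} {v : ℝ≥0} {X chi G : ℕ → Ω → ℝ} {g : Ω → ℝ}
    (hnet : IsDownlink P lamd mu w v X chi G g) (hlamd : 0 < lamd) (hmu : 0 < mu)
    (alpha : ℝ) :
    IsRadialPoisson P (2 * lamD lamd alpha w v) (expMeasure mu) (displaced alpha X chi) G := by
  have := isProbabilityMeasure_expMeasure hmu
  have hXm := hnet.poisson.measurable
  refine ⟨measurable_displaced hXm hnet.chi_measurable alpha, hnet.G_measurable, fun h hh => ?_⟩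
  have hXs : Measurable fun ω i => X i ω := measurable_pi_lambda _ hXm
  have hcs : Measurable fun ω i => chi i ω := measurable_pi_lambda _ hnet.chi_measurable
  have hGs : Measurable fun ω i => G i ω := measurable_pi_lambda _ hnet.G_measurable
  have hind1 : IndepFun (fun ω i => (X i ω, chi i ω)) (fun ω i => G i ω) P := by
    have h1 := indepFun_prodMk_left hXs hcs (hGs.prodMk hnet.g_measurable) hnet.indep_X
      hnet.indep_chi
    refine h1.comp (φ := fun p : (ℕ → ℝ) × (ℕ → ℝ) => fun i => (p.1 i, p.2 i))
      (measurable_pi_lambda _ fun i => ?_) measurable_fst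
    exact ((measurable_pi_apply i).comp measurable_fst).prodMk
      ((measurable_pi_apply i).comp measurable_snd)
  have hind2 : IndepFun (fun ω i => X i ω) (fun ω i => chi i ω) P :=
    hnet.indep_X.comp measurable_id measurable_fst
  set φ : ℝ → ℝ≥0∞ := fun r => ∫⁻ x, expNeg (h (r, x)) ∂expMeasure mu with hφdef
  have hφ : Measurable φ := (measurable_expNeg.comp hh).lintegral_prod_right'
  have hφ1 : ∀ r, φ r ≤ 1 := fun r => (lintegral_mono fun x => expNeg_le_one _).trans (by simp)
  have hd : Measurable fun p : ℝ × ℝ => |p.2 ^ (-(1 / alpha)) * p.1| := by fun_prop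
  have e1 := lintegral_expNeg_marks (P := P) (ρ := expMeasure mu) (U := fun i ω => (X i ω, chi i ω))
    (V := G) (Ψ := fun q : (ℝ × ℝ) × ℝ => h (|q.1.2 ^ (-(1 / alpha)) * q.1.1|, q.2))
    (fun i => (hXm i).prodMk (hnet.chi_measurable i)) hnet.G_measurable
    (fun i => (hnet.G_law i).map_eq) hnet.G_indep hind1
    (hh.comp ((hd.comp measurable_fst).prodMk measurable_snd))
  have hψ1 : Measurable fun p : ℝ × ℝ => negLog (φ |p.2 ^ (-(1 / alpha)) * p.1|) :=
    measurable_negLog.comp (hφ.comp hd)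
  have e2 := lintegral_expNeg_marks (P := P) (ρ := shadowing w v) (U := X) (V := chi)
    hXm hnet.chi_measurable hnet.map_chi hnet.chi_indep hind2 hψ1
  -- Averages of `expNeg` are at most `1`, so `negLog` is inverted exactly and the three stages
  -- (gains, shadowing, positions) chain together.
  simp only [expNeg_negLog (hφ1 _)] at e2
  have hφ2 : ∀ x, ∫⁻ c, φ |c ^ (-(1 / alpha)) * x| ∂shadowing w v ≤ 1 := fun x =>
    (lintegral_mono fun x => hφ1 _).trans (by simp)
  have e3 := hnet.poisson.lintegral_expNeg hlamd.le
    (ψ := fun x => negLog (∫⁻ c, φ |c ^ (-(1 / alpha)) * x| ∂shadowing w v))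
    (measurable_negLog.comp (hφ.comp hd).lintegral_prod_right')
  simp only [expNeg_negLog (hφ2 _)] at e3
  refine (e1.trans (e2.trans e3)).trans ?_
  congr 1
  have e4 : ∀ x : ℝ, 1 - ∫⁻ c, φ |c ^ (-(1 / alpha)) * x| ∂shadowing w v
      = ∫⁻ c, (1 - φ |c ^ (-(1 / alpha)) * x|) ∂shadowing w v := by
    intro x
    rw [lintegral_sub (g := fun c => φ |c ^ (-(1 / alpha)) * x|)
      (hφ.comp (hd.comp measurable_prodMk_left)) (ne_top_of_le_ne_top ENNReal.one_ne_top (hφ2 x)) (ae_of_all _ fun c => hφ1 _)]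
    simp
  simp_rw [e4]
  rw [lintegral_lintegral_swap (measurable_const.sub (hφ.comp hd)).aemeasurable]
  -- For a fixed shadowing value the dilation by `c ^ (-(1 / alpha))` has Jacobian `c ^ (1 /
  -- alpha)`, and folding the line gives the factor `2`.
  have e5 : ∀ᵐ c ∂shadowing w v, ∫⁻ x, (1 - φ |c ^ (-(1 / alpha)) * x|)
      = ENNReal.ofReal (c ^ (1 / alpha)) * (2 * ∫⁻ r in Ioi 0, (1 - φ r)) := by
    filter_upwards [ae_shadowing_pos w v] with c hc
    rw [lintegral_comp_abs_mul (f := fun r => 1 - φ r) (measurable_const.sub hφ) (Real.rpow_pos_of_pos hc _),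
      Real.rpow_neg hc.le, inv_inv]
  rw [lintegral_congr_ae e5, lintegral_mul_const _ (by fun_prop), lintegral_shadowing_rpow,
    lamD, ENNReal.ofReal_mul (by norm_num), ENNReal.ofReal_mul (Real.exp_pos _).le,
    ENNReal.ofReal_ofNat]
  have e6 : w * (Real.log 10 / 10 * (1 / alpha)) + v * (Real.log 10 / 10 * (1 / alpha)) ^ 2 / 2
      = w * Real.log 10 / (10 * alpha) + 1 / 2 * v * (Real.log 10 / (10 * alpha)) ^ 2 := by
    have : Real.log 10 / 10 * (1 / alpha) = Real.log 10 / (10 * alpha) := by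
      rw [div_mul_div_comm, mul_one]
    rw [this]
    ring
  rw [e6]
  ring

/-! ### Ordering a locally finite sequence of distinct positive numbers -/

/-- The numbers `d i` are positive, distinct, and finitely many of them lie in a bounded set. -/
structure IsSimpleConfig (d : ℕ → ℝ) : Prop where
  pos : ∀ i, 0 < d i
  finite : ∀ r, {i | d i ≤ r}.Finite
  inj : Function.Injective d

/-- The `k`-th smallest of the numbers `d i`, with value `0` for `k = 0`. -/
noncomputable def orderStat (d : ℕ → ℝ) : ℕ → ℝ
  | 0 => 0
  | k + 1 => sInf {r : ℝ | 0 ≤ r ∧ ((k + 1 : ℕ) : ℕ∞) ≤ {i : ℕ | d i ≤ r}.encard}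

namespace IsSimpleConfig

variable {d : ℕ → ℝ}

lemma exists_gap (hd : IsSimpleConfig d) (r : ℝ) : ∃ r' > r, {i | d i ≤ r'} = {i | d i ≤ r} := by
  have hF : {i | r < d i ∧ d i ≤ r + 1}.Finite := (hd.finite (r + 1)).subset fun i hi => hi.2
  have h1 : ∀ᶠ c in 𝓝[>] r, ∀ i ∈ {i | r < d i ∧ d i ≤ r + 1}, c < d i := by
    rw [eventually_all_finite hF]
    intro i hi
    exact nhdsWithin_le_nhds (Iio_mem_nhds hi.1)
  have h2 : ∀ᶠ c in 𝓝[>] r, c ≤ r + 1 :=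
    nhdsWithin_le_nhds (Iic_mem_nhds (by linarith))
  obtain ⟨c, hc, hc1, hcr⟩ := (h1.and (h2.and self_mem_nhdsWithin)).exists
  refine ⟨c, hcr, Set.ext fun i => ⟨fun hi => ?_, fun hi => le_trans hi (le_of_lt hcr)⟩⟩
  by_contra hlt
  exact absurd (hc i ⟨not_le.1 hlt, le_trans hi hc1⟩) (not_lt.2 hi)

lemma orderStat_succ_le_iff (hd : IsSimpleConfig d) (k : ℕ) (r : ℝ) :
    orderStat d (k + 1) ≤ r ↔ ((k + 1 : ℕ) : ℕ∞) ≤ {i | d i ≤ r}.encard := by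
  set S := {r : ℝ | 0 ≤ r ∧ ((k + 1 : ℕ) : ℕ∞) ≤ {i : ℕ | d i ≤ r}.encard} with hS
  have hbdd : BddBelow S := ⟨0, fun r hr => hr.1⟩
  have hne : S.Nonempty := by
    -- The sum of the first `k + 1` terms bounds each of them, as all terms are positive.
    refine ⟨∑ i ∈ Finset.range (k + 1), d i, Finset.sum_nonneg fun i _ => (hd.pos i).le, ?_⟩
    have : ((Finset.range (k + 1) : Finset ℕ) : Set ℕ)
        ⊆ {i | d i ≤ ∑ i ∈ Finset.range (k + 1), d i} := fun i hi =>
      Finset.single_le_sum (f := d) (fun j _ => (hd.pos j).le) (Finset.mem_coe.1 hi)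
    have h2 := encard_le_encard this
    rwa [encard_coe_eq_coe_finsetCard, Finset.card_range] at h2
  -- The infimum is attained because, by local finiteness, no new point appears immediately to the
  -- right of it.
  have hmem : sInf S ∈ S := by
    have h0 : 0 ≤ sInf S := le_csInf hne fun r hr => hr.1
    refine ⟨h0, ?_⟩
    by_contra hlt
    obtain ⟨r', hr', heq⟩ := hd.exists_gap (sInf S)
    refine absurd hr' (not_lt.2 (le_csInf hne fun s hs => ?_))
    by_contra hsr
    refine hlt (hs.2.trans ?_)
    rw [← heq]
    exact encard_le_encard fun i hi => le_trans hi (le_of_lt (not_le.1 hsr))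
  constructor
  · intro h
    exact hmem.2.trans (encard_le_encard fun i hi => le_trans hi h)
  · intro h
    have h0 : 0 ≤ r := by
      by_contra hr
      have : {i | d i ≤ r} = ∅ := by
        ext i
        simp only [mem_ofPred_eq, mem_empty_iff_false, iff_false, not_le]
        exact lt_trans (not_le.1 hr) (hd.pos i)
      rw [this, encard_empty] at h
      simp at h
    exact csInf_le hbdd ⟨h0, h⟩

lemma exists_lt_of_le_encard (hd : IsSimpleConfig d) {n : ℕ} (hn : 0 < n) {y : ℝ}
    (h : (n : ℕ∞) ≤ {i | d i < y}.encard) : ∃ r < y, (n : ℕ∞) ≤ {i | d i ≤ r}.encard := by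
  have hfin : {i | d i < y}.Finite := (hd.finite y).subset fun i (hi : d i < y) => hi.le
  have hne : {i | d i < y}.Nonempty := by
    rw [← encard_pos]
    exact lt_of_lt_of_le (by exact_mod_cast hn) h
  obtain ⟨j, hj, hmax⟩ := hfin.exists_maximalFor d _ hne
  refine ⟨d j, hj, h.trans (encard_le_encard fun i hi => ?_)⟩
  by_contra hlt
  exact hlt (hmax hi (le_of_lt (not_le.1 hlt)))

/-- Injectivity excludes ties: at most one point sits at the order statistic, so the count cannot
jump past `k`. -/
lemma encard_le_orderStat (hd : IsSimpleConfig d) (k : ℕ) :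
    {i | d i ≤ orderStat d k}.encard = k := by
  cases k with
  | zero =>
    have : {i | d i ≤ orderStat d 0} = ∅ := by
      ext i
      simpa [orderStat] using hd.pos i
    rw [this]
    simp
  | succ k =>
    refine le_antisymm ?_ ((hd.orderStat_succ_le_iff k _).1 le_rfl)
    by_contra hlt
    rw [not_le] at hlt
    set t := orderStat d (k + 1)
    have hsub : {i | d i ≤ t} ⊆ {i | d i < t} ∪ {i | d i = t} := fun i hi =>
      (lt_or_eq_of_le (show d i ≤ t from hi)).imp id id
    have h1 : {i | d i = t}.encard ≤ 1 := encard_le_one_iff.2 fun a b ha hb =>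
      hd.inj ((show d a = t from ha).trans (show d b = t from hb).symm)
    have h2 : {i | d i ≤ t}.encard ≤ {i | d i < t}.encard + 1 :=
      (encard_le_encard hsub).trans ((encard_union_le _ _).trans (by gcongr))
    have h3 : ((k + 1 : ℕ) : ℕ∞) ≤ {i | d i < t}.encard := by
      have h4 := hlt.trans_le h2
      exact (ENat.lt_add_one_iff' (ENat.natCast_ne_top _)).1 h4
    obtain ⟨r, hr, hr'⟩ := hd.exists_lt_of_le_encard k.succ_pos h3
    exact absurd ((hd.orderStat_succ_le_iff k r).2 hr') (not_le.2 hr)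

/-- This turns a statement about the next distance into the absence of points in `(orderStat d k,
c]`, which a Laplace functional with value `∞` can express. -/
lemma lt_orderStat_succ_iff (hd : IsSimpleConfig d) (k : ℕ) (c : ℝ) :
    c < orderStat d (k + 1) ↔ ∀ i, orderStat d k < d i → c < d i := by
  rw [← not_le, hd.orderStat_succ_le_iff, not_le]
  constructor
  · intro h i hi
    by_contra hc
    rw [not_lt] at hc
    have h1 : insert i {j | d j ≤ orderStat d k} ⊆ {j | d j ≤ c} := by
      rw [insert_subset_iff]
      exact ⟨hc, fun j hj => le_trans hj (hi.le.trans hc)⟩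
    have h2 := encard_le_encard h1
    rw [encard_insert_of_notMem (by simpa using hi), hd.encard_le_orderStat] at h2
    exact absurd (h2.trans_lt h) (by simp)
  · intro h
    have h1 : {i | d i ≤ c} ⊆ {i | d i ≤ orderStat d k} := by
      intro i hi
      by_contra hlt
      exact absurd (h i (not_le.1 hlt)) (not_lt.2 hi)
    refine (encard_le_encard h1).trans_lt ?_
    rw [hd.encard_le_orderStat]
    exact_mod_cast k.lt_succ_self

lemma orderStat_lt_succ (hd : IsSimpleConfig d) (k : ℕ) : orderStat d k < orderStat d (k + 1) :=
  (hd.lt_orderStat_succ_iff k _).2 fun _ hi => hi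

/-- Used to identify the stations outside `cooperating` with those beyond the `m`-th distance. -/
lemma le_encard_lt_iff (hd : IsSimpleConfig d) {m : ℕ} (hm : 0 < m) (y : ℝ) :
    (m : ℕ∞) ≤ {i | d i < y}.encard ↔ orderStat d m < y := by
  obtain ⟨k, rfl⟩ : ∃ k, m = k + 1 := ⟨m - 1, by omega⟩
  constructor
  · intro h
    obtain ⟨r, hr, hr'⟩ := hd.exists_lt_of_le_encard hm h
    exact ((hd.orderStat_succ_le_iff k r).2 hr').trans_lt hr
  · intro h
    rw [← hd.encard_le_orderStat (k + 1)]
    exact encard_le_encard fun i hi => lt_of_le_of_lt hi h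

end IsSimpleConfig

/-! ### Measurability of the distances and of the interference. -/

lemma interference_eq_tsum {Ω : Type*} {Y G : ℕ → Ω → ℝ} (Pd alpha : ℝ) (m : ℕ) (ω : Ω) :
    interference Pd alpha Y G m ω = ∑' i, ((cooperating Y m ω)ᶜ : Set ℕ).indicator
      (fun i => ENNReal.ofReal (Pd * G i ω * |Y i ω| ^ (-alpha))) i :=
  tsum_subtype ((cooperating Y m ω)ᶜ : Set ℕ)
    (fun i => ENNReal.ofReal (Pd * G i ω * |Y i ω| ^ (-alpha)))

section Measurability

variable {Ω : Type*} [MeasurableSpace Ω] {Y G : ℕ → Ω → ℝ}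

lemma measurable_nthDist (hY : ∀ i, Measurable (Y i)) (k : ℕ) : Measurable (nthDist Y k) := by
  have habs : ∀ i, Measurable fun ω => |Y i ω| := fun i => (hY i).abs
  have hN : ∀ r : ℝ, MeasurableSet {ω | ((k + 1 : ℕ) : ℕ∞) ≤ {i : ℕ | |Y i ω| ≤ r}.encard} :=
    fun r => (measurable_encard (p := fun i ω => |Y i ω| ≤ r)
      fun i => habs i measurableSet_Iic) (MeasurableSet.of_discrete (s := Ici _))
  refine measurable_of_Iio fun r => ?_
  -- The second set in the union covers configurations with too few points in every bounded set,
  -- where the infimum of the empty set is `0`.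
  have : nthDist Y k ⁻¹' Iio r
      = (⋃ q : ℚ, {ω | (0 ≤ (q : ℝ) ∧ (q : ℝ) < r) ∧
          ((k + 1 : ℕ) : ℕ∞) ≤ {i : ℕ | |Y i ω| ≤ (q : ℝ)}.encard}) ∪
        ((⋂ n : ℕ, {ω | ((k + 1 : ℕ) : ℕ∞) ≤ {i : ℕ | |Y i ω| ≤ (n : ℝ)}.encard}ᶜ)
          ∩ {_ω | 0 < r}) := by
    ext ω
    simp only [mem_preimage, mem_Iio, mem_union, mem_iUnion, mem_ofPred_eq, mem_inter_iff,
      mem_iInter, mem_compl_iff]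
    set S := {r : ℝ | 0 ≤ r ∧ ((k + 1 : ℕ) : ℕ∞) ≤ {i : ℕ | |Y i ω| ≤ r}.encard} with hS
    have hT : nthDist Y k ω = sInf S := rfl
    have hbdd : BddBelow S := ⟨0, fun r hr => hr.1⟩
    have hup : ∀ s ∈ S, ∀ q, s ≤ q → ((k + 1 : ℕ) : ℕ∞) ≤ {i : ℕ | |Y i ω| ≤ q}.encard :=
      fun s hs q hq => hs.2.trans (encard_le_encard fun i hi => le_trans hi hq)
    rw [hT]
    rcases S.eq_empty_or_nonempty with h | h
    · rw [h, Real.sInf_empty]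
      constructor
      · intro hr
        refine Or.inr ⟨fun n hn => ?_, hr⟩
        exact (h ▸ (show (n : ℝ) ∈ S from ⟨n.cast_nonneg, hn⟩) : (n : ℝ) ∈ (∅ : Set ℝ))
      · rintro (⟨q, ⟨h0, hr⟩, _⟩ | ⟨_, hr⟩)
        · exact h0.trans_lt hr
        · exact hr
    · rw [csInf_lt_iff hbdd h]
      constructor
      · rintro ⟨s, hs, hsr⟩
        obtain ⟨q, hq1, hq2⟩ := exists_rat_btwn hsr
        exact Or.inl ⟨q, ⟨hs.1.trans hq1.le, hq2⟩, hup s hs q hq1.le⟩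
      · rintro (⟨q, ⟨h0, hr⟩, hq⟩ | ⟨hn, _⟩)
        · exact ⟨q, ⟨h0, hq⟩, hr⟩
        · obtain ⟨s, hs⟩ := h
          obtain ⟨n, hn'⟩ := exists_nat_ge s
          exact absurd (hup s hs n hn') (hn n)
  rw [this]
  refine (MeasurableSet.iUnion fun q : ℚ => (MeasurableSet.const _).inter (hN q)).union
    ((MeasurableSet.iInter fun n : ℕ => (hN n).compl).inter (MeasurableSet.const _))

lemma measurable_dists (hY : ∀ i, Measurable (Y i)) (m : ℕ) : Measurable (dists Y m) :=
  measurable_pi_lambda _ fun k => measurable_nthDist hY k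

lemma measurable_interference (hY : ∀ i, Measurable (Y i)) (hG : ∀ i, Measurable (G i))
    (Pd alpha : ℝ) (m : ℕ) : Measurable (interference Pd alpha Y G m) := by
  have habs : ∀ i, Measurable fun ω => |Y i ω| := fun i => (hY i).abs
  have hc : ∀ i, MeasurableSet {ω | i ∈ (cooperating Y m ω)ᶜ} := by
    intro i
    refine MeasurableSet.compl ((measurable_encard (p := fun k ω => |Y k ω| < |Y i ω|)
      fun k => measurableSet_lt (habs k) (habs i)) (MeasurableSet.of_discrete (s := Iio _)))
  rw [funext (interference_eq_tsum (Y := Y) (G := G) Pd alpha m)]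
  refine Measurable.tsum fun i => ?_
  have hm : Measurable ({ω | i ∈ (cooperating Y m ω)ᶜ}.indicator
      fun ω => ENNReal.ofReal (Pd * G i ω * |Y i ω| ^ (-alpha))) :=
    Measurable.indicator (((hG i).const_mul Pd).mul
      ((habs i).pow_const (-alpha))).ennreal_ofReal (hc i)
  convert hm using 1
  funext ω
  simp only [indicator, mem_ofPred_eq]

end Measurability

/-! ### Almost sure properties of the distances -/

lemma encard_eq_tsum_indicator (d : ℕ → ℝ) (A : Set ℝ) :
    (({i | d i ∈ A}.encard : ℕ∞) : ℝ≥0∞) = ∑' i, A.indicator (fun _ => (1 : ℝ≥0∞)) (d i) := by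
  rw [← ENNReal.tsum_set_one, tsum_subtype {i | d i ∈ A} (fun _ => (1 : ℝ≥0∞))]
  rfl

namespace IsRadialPoisson

variable {Ω : Type*} [MeasurableSpace Ω] {P : Measure Ω} {L : ℝ}
  {ρ : Measure ℝ} [IsProbabilityMeasure ρ] {Y G : ℕ → Ω → ℝ}

lemma lintegral_expNeg_mul_encard (hY : IsRadialPoisson P L ρ Y G) {A : Set ℝ}
    (hA : MeasurableSet A) (y : ℝ≥0∞) :
    ∫⁻ ω, expNeg (y * (({i | |Y i ω| ∈ A}.encard : ℕ∞) : ℝ≥0∞)) ∂P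
      = expNeg (ENNReal.ofReal L * ((1 - expNeg y) * volume (A ∩ Ioi 0))) := by
  have h1 := hY.laplace (fun p => A.indicator (fun _ => y) p.1)
    ((measurable_const.indicator hA).comp measurable_fst)
  have h2 : ∀ ω, y * (({i | |Y i ω| ∈ A}.encard : ℕ∞) : ℝ≥0∞)
      = ∑' i, A.indicator (fun _ => y) |Y i ω| := by
    intro ω
    rw [encard_eq_tsum_indicator (fun i => |Y i ω|), ← ENNReal.tsum_mul_left]
    refine tsum_congr fun i => ?_
    by_cases h : |Y i ω| ∈ A <;> simp [h]
  simp_rw [h2]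
  rw [h1]
  congr 2
  simp only [lintegral_const, measure_univ, mul_one]
  have h3 : ∀ r, 1 - expNeg (A.indicator (fun _ => y) r)
      = A.indicator (fun _ => 1 - expNeg y) r := by
    intro r
    by_cases h : r ∈ A <;> simp [h]
  simp_rw [h3]
  rw [lintegral_indicator_const hA, Measure.restrict_apply hA]

variable [IsProbabilityMeasure P]

lemma ae_pos (hY : IsRadialPoisson P L ρ Y G) : ∀ᵐ ω ∂P, ∀ i, 0 < |Y i ω| := by
  -- With weight `∞` the integrand is the indicator that no distance equals `0`; its mean is `1`
  -- because `{0}` does not meet `(0, ∞)`.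
  have h1 := hY.lintegral_expNeg_mul_encard (A := {0}) (measurableSet_singleton _) ∞
  have h2 : volume ({0} ∩ Ioi (0 : ℝ)) = 0 := measure_mono_null inter_subset_left (by simp)
  rw [h2] at h1
  have h3 := ae_eq_of_ae_le_of_lintegral_le (μ := P) (f := fun ω =>
    expNeg (∞ * (({i | |Y i ω| ∈ ({0} : Set ℝ)}.encard : ℕ∞) : ℝ≥0∞))) (g := fun _ => 1)
    (ae_of_all _ fun ω => expNeg_le_one _) (by rw [h1]; simp) aemeasurable_const
    (by rw [h1]; simp)
  filter_upwards [h3] with ω hω i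
  refine lt_of_le_of_ne (abs_nonneg _) fun h0 => ?_
  have : (({i | |Y i ω| ∈ ({0} : Set ℝ)}.encard : ℕ∞) : ℝ≥0∞) ≠ 0 := by
    rw [Ne, ENat.toENNReal_eq_zero, encard_eq_zero]
    exact Nonempty.ne_empty ⟨i, h0.symm⟩
  rw [ENNReal.top_mul this, expNeg_top] at hω
  exact zero_ne_one hω

lemma ae_finite (hY : IsRadialPoisson P L ρ Y G) :
    ∀ᵐ ω ∂P, ∀ r : ℝ, {i | |Y i ω| ≤ r}.Finite := by
  have key : ∀ n : ℕ, ∀ᵐ ω ∂P, {i | |Y i ω| ∈ Iic (n : ℝ)}.Finite := by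
    intro n
    set N : Ω → ℕ∞ := fun ω => {i | |Y i ω| ∈ Iic (n : ℝ)}.encard with hN
    have hNm : Measurable N :=
      measurable_encard fun i => (hY.measurable_Y i).abs measurableSet_Iic
    have hfinset : MeasurableSet {ω | N ω ≠ ⊤} :=
      hNm (MeasurableSet.of_discrete (s := {x : ℕ∞ | x ≠ ⊤}))
    -- For `y > 0` one has `exp (-y N) ≤ 1_{N < ∞}`, and the mean of the left side tends to `1` as
    -- `y = 1 / (k + 1)` tends to `0`.
    have hle : ∀ k : ℕ, expNeg (ENNReal.ofReal L * ((1 - expNeg ((k : ℝ≥0∞) + 1)⁻¹)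
        * volume (Iic (n : ℝ) ∩ Ioi 0))) ≤ P {ω | N ω ≠ ⊤} := by
      intro k
      rw [← hY.lintegral_expNeg_mul_encard measurableSet_Iic, ← lintegral_indicator_one hfinset]
      refine lintegral_mono fun ω => ?_
      by_cases h : N ω = ⊤
      · have h' : {i | |Y i ω| ∈ Iic (n : ℝ)}.encard = ⊤ := h
        rw [h', ENat.toENNReal_top, ENNReal.mul_top (by simp), expNeg_top]
        exact zero_le
      · rw [indicator_of_mem (show ω ∈ {ω | N ω ≠ ⊤} from h)]
        exact expNeg_le_one _
    have hvol : volume (Iic (n : ℝ) ∩ Ioi 0) ≠ ∞ := by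
      rw [Iic_inter_Ioi]
      exact measure_Ioc_lt_top.ne
    have hinv : Tendsto (fun k : ℕ => ((k : ℝ≥0∞) + 1)⁻¹) atTop (𝓝 0) := by
      have := (tendsto_add_atTop_iff_nat 1).2 ENNReal.tendsto_inv_nat_nhds_zero
      simpa using this
    have hlim : Tendsto (fun k : ℕ => expNeg (ENNReal.ofReal L * ((1 - expNeg ((k : ℝ≥0∞) + 1)⁻¹)
        * volume (Iic (n : ℝ) ∩ Ioi 0)))) atTop (𝓝 1) := by
      have h1 : Tendsto (fun k : ℕ => 1 - expNeg ((k : ℝ≥0∞) + 1)⁻¹) atTop (𝓝 (1 - expNeg 0)) :=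
        ENNReal.Tendsto.sub tendsto_const_nhds ((continuous_expNeg.tendsto _).comp hinv)
          (Or.inl ENNReal.one_ne_top)
      have h2 := ENNReal.Tendsto.const_mul (a := ENNReal.ofReal L)
        (ENNReal.Tendsto.mul_const h1 (Or.inr hvol)) (Or.inr ENNReal.ofReal_ne_top)
      have h3 := (continuous_expNeg.tendsto _).comp h2
      simpa [Function.comp_def] using h3
    have hone : P {ω | N ω ≠ ⊤} = 1 :=
      le_antisymm prob_le_one (le_of_tendsto' hlim hle)
    have := (prob_compl_eq_zero_iff hfinset).2 hone
    filter_upwards [measure_eq_zero_iff_ae_notMem.1 this] with ω hω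
    simp only [mem_compl_iff, not_not] at hω
    exact encard_ne_top_iff.1 hω
  filter_upwards [ae_all_iff.2 key] with ω hω r
  obtain ⟨n, hn⟩ := exists_nat_ge r
  exact (hω n).subset fun i (hi : |Y i ω| ≤ r) => hi.trans hn

/-- With `θ = L δ` and `z = exp (-θ / 2)`, the means of `2^(-N)` and of `1_{N = 0}` are `z` and
`z²`. A pointwise inequality then bounds the probability by `2 (1 - z)²`, which is at most `θ² / 2`.
-/
lemma measure_two_le_encard (hY : IsRadialPoisson P L ρ Y G) (hL : 0 ≤ L) {a δ : ℝ} (ha : 0 ≤ a)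
    (hδ : 0 ≤ δ) :
    P {ω | 2 ≤ {i | |Y i ω| ∈ Ioc a (a + δ)}.encard} ≤ ENNReal.ofReal ((L * δ) ^ 2 / 2) := by
  set N : Ω → ℕ∞ := fun ω => {i | |Y i ω| ∈ Ioc a (a + δ)}.encard with hN
  have hNm : Measurable N := measurable_encard fun i => (hY.measurable_Y i).abs measurableSet_Ioc
  have hset : MeasurableSet {ω | 2 ≤ N ω} := hNm (MeasurableSet.of_discrete (s := Ici 2))
  set θ := L * δ
  have hθ : 0 ≤ θ := mul_nonneg hL hδ
  have hvol : volume (Ioc a (a + δ) ∩ Ioi 0) = ENNReal.ofReal δ := by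
    rw [inter_eq_left.2 (Ioc_subset_Ioi_self.trans (Ioi_subset_Ioi ha)), Real.volume_Ioc]
    congr 1
    ring
  have hhalf : expNeg (ENNReal.ofReal (Real.log 2)) = ENNReal.ofReal (1 / 2) := by
    rw [expNeg_ofReal (Real.log_nonneg (by norm_num)), Real.exp_neg, Real.exp_log (by norm_num),
      one_div]
  have e1 : ∫⁻ ω, expNeg (ENNReal.ofReal (Real.log 2) * (N ω : ℝ≥0∞)) ∂P
      = ENNReal.ofReal (Real.exp (-(θ / 2))) := by
    rw [hY.lintegral_expNeg_mul_encard measurableSet_Ioc, hvol, hhalf, ← ENNReal.ofReal_one,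
      ← ENNReal.ofReal_sub _ (by norm_num), ← ENNReal.ofReal_mul (by norm_num),
      ← ENNReal.ofReal_mul hL, expNeg_ofReal (by positivity)]
    congr 3
    ring
  have e2 : ∫⁻ ω, expNeg (∞ * (N ω : ℝ≥0∞)) ∂P = ENNReal.ofReal (Real.exp (-θ)) := by
    rw [hY.lintegral_expNeg_mul_encard measurableSet_Ioc, hvol, expNeg_top, tsub_zero, one_mul,
      ← ENNReal.ofReal_mul hL, expNeg_ofReal hθ]
  -- This says `1_{N ≥ 2} + 4 · 2^(-N) ≤ 2 + 2 · 1_{N = 0}`. Equality holds for `N = 0, 1, 2`.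
  have hpt : ∀ ω, {ω | 2 ≤ N ω}.indicator 1 ω
      + 4 * expNeg (ENNReal.ofReal (Real.log 2) * (N ω : ℝ≥0∞))
      ≤ 2 + 2 * expNeg (∞ * (N ω : ℝ≥0∞)) := by
    intro ω
    rcases eq_or_ne (N ω) ⊤ with h | h
    · have : {ω | 2 ≤ N ω}.indicator (1 : Ω → ℝ≥0∞) ω ≤ 1 := indicator_le_self' (by simp) ω
      have hlog : ENNReal.ofReal (Real.log 2) ≠ 0 := by
        simpa using Real.log_pos (by norm_num : (1 : ℝ) < 2)
      rw [h, ENat.toENNReal_top, ENNReal.mul_top hlog, expNeg_top, mul_zero, add_zero]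
      exact (this.trans (by norm_num)).trans le_self_add
    · obtain ⟨n, hn⟩ := ENat.ne_top_iff_exists.1 h
      rw [← hn, ENat.toENNReal_coe, expNeg_mul_nat, expNeg_mul_nat, hhalf, expNeg_top]
      rcases lt_or_ge n 2 with h2 | h2
      · have hi : ω ∉ {ω | 2 ≤ N ω} := by
          simp only [mem_ofPred_eq, ← hn, not_le]
          exact_mod_cast h2
        rw [indicator_of_notMem hi, zero_add]
        interval_cases n
        · norm_num
        · rw [pow_one, ← ENNReal.ofReal_ofNat 4, ← ENNReal.ofReal_mul (by norm_num)]
          norm_num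
      · have hi : ω ∈ {ω | 2 ≤ N ω} := by
          simp only [mem_ofPred_eq, ← hn]
          exact_mod_cast h2
        rw [indicator_of_mem hi, Pi.one_apply, ← ENNReal.ofReal_pow (by norm_num),
          ← ENNReal.ofReal_ofNat 4, ← ENNReal.ofReal_mul (by norm_num)]
        refine le_trans ?_ (le_self_add (a := (2 : ℝ≥0∞)))
        have : (4 : ℝ) * (1 / 2) ^ n ≤ 1 := by
          have := pow_le_pow_of_le_one (by norm_num : (0 : ℝ) ≤ 1 / 2) (by norm_num) h2
          linarith
        calc 1 + ENNReal.ofReal (4 * (1 / 2) ^ n) ≤ 1 + ENNReal.ofReal 1 := by gcongr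
          _ = 2 := by norm_num
  have hint := lintegral_mono (μ := P) hpt
  have hm1 : Measurable fun ω => expNeg (∞ * (N ω : ℝ≥0∞)) :=
    (Measurable.of_discrete (f := fun n : ℕ∞ => expNeg (∞ * (n : ℝ≥0∞)))).comp hNm
  rw [lintegral_add_left (measurable_one.indicator hset), lintegral_indicator_one hset,
    lintegral_const_mul' _ _ (by norm_num), e1, lintegral_add_left measurable_const,
    lintegral_const_mul' _ _ (by norm_num), e2, lintegral_const, measure_univ, mul_one,
    ← ENNReal.ofReal_ofNat 4, ← ENNReal.ofReal_ofNat 2, ← ENNReal.ofReal_mul (by norm_num),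
    ← ENNReal.ofReal_mul (by norm_num), ← ENNReal.ofReal_add (by norm_num) (by positivity),
    ← ENNReal.ofReal_toReal (measure_ne_top P {ω | 2 ≤ N ω}),
    ← ENNReal.ofReal_add ENNReal.toReal_nonneg (by positivity),
    ENNReal.ofReal_le_ofReal_iff (by positivity)] at hint
  rw [← ENNReal.ofReal_toReal (measure_ne_top P {ω | 2 ≤ N ω})]
  refine ENNReal.ofReal_le_ofReal ?_
  set z := Real.exp (-(θ / 2)) with hz
  have hz2 : Real.exp (-θ) = z ^ 2 := by
    rw [hz, sq, ← Real.exp_add]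
    congr 1
    ring
  have hz1 : z ≤ 1 := Real.exp_le_one_iff.2 (by linarith)
  have hz3 : 1 - z ≤ θ / 2 := by
    have := Real.add_one_le_exp (-(θ / 2))
    linarith
  rw [hz2] at hint
  nlinarith

/-- Cut `(0, M]` into `M (n + 1)` cells of length `1 / (n + 1)`. A tie puts two points in one cell;
each cell contributes `O(n⁻²)`, so the union has probability `O(n⁻¹)`. -/
lemma ae_injective (hY : IsRadialPoisson P L ρ Y G) (hL : 0 ≤ L) :
    ∀ᵐ ω ∂P, Function.Injective fun i => |Y i ω| := by
  have key : ∀ M : ℕ, ∀ᵐ ω ∂P, ¬ ∃ r ∈ Ioc (0 : ℝ) M, 2 ≤ {i | |Y i ω| = r}.encard := by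
    intro M
    set E := {ω | ∃ r ∈ Ioc (0 : ℝ) M, 2 ≤ {i | |Y i ω| = r}.encard} with hE
    have hbound : ∀ n : ℕ, P E ≤ ENNReal.ofReal (M * (n + 1) * ((L * (1 / (n + 1))) ^ 2 / 2)) := by
      intro n
      have hn : (0 : ℝ) < n + 1 := by positivity
      have hsub : E ⊆ ⋃ j ∈ Finset.range (M * (n + 1)),
          {ω | 2 ≤ {i | |Y i ω| ∈ Ioc ((j : ℝ) / (n + 1)) (j / (n + 1) + 1 / (n + 1))}.encard} := by
        rintro ω ⟨r, hr, h2⟩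
        have hc0 : 0 < ⌈r * (n + 1)⌉₊ := Nat.ceil_pos.2 (mul_pos hr.1 hn)
        obtain ⟨j, hj⟩ : ∃ j, ⌈r * (n + 1)⌉₊ = j + 1 := ⟨⌈r * (n + 1)⌉₊ - 1, by omega⟩
        obtain ⟨hj1, hj2⟩ := (Nat.ceil_eq_iff (Nat.succ_ne_zero j)).1 hj
        simp only [Nat.succ_sub_one, Nat.succ_eq_add_one, Nat.cast_add, Nat.cast_one] at hj1 hj2
        simp only [mem_iUnion, mem_ofPred_eq, Finset.mem_range]
        refine ⟨j, ?_, h2.trans (encard_le_encard ?_)⟩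
        · have : (j : ℝ) < M * (n + 1) := hj1.trans_le (by gcongr; exact hr.2)
          exact_mod_cast this
        · intro i (hi : |Y i ω| = r)
          rw [mem_ofPred_eq, hi, ← add_div]
          exact ⟨(div_lt_iff₀ hn).2 hj1, (le_div_iff₀ hn).2 hj2⟩
      refine (measure_mono hsub).trans ((measure_biUnion_finset_le _ _).trans ?_)
      refine (Finset.sum_le_sum fun (j : ℕ) _ =>
        hY.measure_two_le_encard hL (a := (j : ℝ) / (n + 1))
          (δ := 1 / ((n : ℝ) + 1)) (div_nonneg j.cast_nonneg hn.le) (by positivity)).trans ?_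
      rw [Finset.sum_const, Finset.card_range, nsmul_eq_mul, ← ENNReal.ofReal_natCast,
        ← ENNReal.ofReal_mul (by positivity)]
      push_cast
      exact le_rfl
    have hlim : Tendsto (fun n : ℕ => ENNReal.ofReal
        (M * (n + 1) * ((L * (1 / ((n : ℝ) + 1))) ^ 2 / 2))) atTop (𝓝 0) := by
      have h1 : Tendsto (fun n : ℕ => M * L ^ 2 / 2 * (1 / ((n : ℝ) + 1))) atTop (𝓝 0) := by
        have := (tendsto_one_div_add_atTop_nhds_zero_nat (𝕜 := ℝ)).const_mul (M * L ^ 2 / 2)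
        rwa [mul_zero] at this
      have h2 := ENNReal.tendsto_ofReal h1
      rw [ENNReal.ofReal_zero] at h2
      refine h2.congr fun n => ?_
      congr 1
      have hn : (n : ℝ) + 1 ≠ 0 := by positivity
      field_simp
    have hzero : P E = 0 := le_antisymm (ge_of_tendsto' hlim hbound) zero_le
    exact measure_eq_zero_iff_ae_notMem.1 hzero
  filter_upwards [ae_all_iff.2 key, hY.ae_pos] with ω hω hpos i j (hij : |Y i ω| = |Y j ω|)
  by_contra hne
  obtain ⟨M, hM⟩ := exists_nat_ge |Y i ω|
  refine hω M ⟨|Y i ω|, ⟨hpos i, hM⟩, ?_⟩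
  rw [← encard_pair hne]
  refine encard_le_encard ?_
  rintro k (rfl | rfl)
  · rfl
  · exact hij.symm

theorem ae_isSimpleConfig (hY : IsRadialPoisson P L ρ Y G) (hL : 0 ≤ L) :
    ∀ᵐ ω ∂P, IsSimpleConfig fun i => |Y i ω| := by
  filter_upwards [hY.ae_pos, hY.ae_finite, hY.ae_injective hL] with ω h1 h2 h3
  exact ⟨h1, h2, h3⟩

end IsRadialPoisson

/-! ### Approximation from the right on a grid -/

/-- Monotonicity gives the upper bound for free, so only lower semicontinuity from the right has to
be checked. -/
lemma continuousWithinAt_Ici_of_antitone {f : ℝ → ℝ≥0∞} (hf : Antitone f) {u : ℝ}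
    (h : ∀ y < f u, ∃ c > u, y < f c) : ContinuousWithinAt f (Ici u) u := by
  refine tendsto_order.2 ⟨fun y hy => ?_, fun y hy => ?_⟩
  · obtain ⟨c, hc, hyc⟩ := h y hy
    filter_upwards [nhdsWithin_le_nhds (Iio_mem_nhds hc)] with d hd
    exact hyc.trans_le (hf (le_of_lt hd))
  · filter_upwards [self_mem_nhdsWithin] with d hd
    exact (hf hd).trans_lt hy

/-- On each cell `T` is replaced by the right endpoint, which exceeds `T` by at most the mesh; right
continuity and domination by the indicator of `T ⁻¹' Ioc a b` give the limit. -/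
theorem tendsto_sum_grid {α : Type*} [MeasurableSpace α] {μ : Measure α} {T : α → ℝ}
    (hT : Measurable T) {Φ : ℝ → α → ℝ≥0∞} (hΦm : ∀ c, Measurable (Φ c))
    (hΦ1 : ∀ c x, Φ c x ≤ 1)
    (hΦc : ∀ x, ContinuousWithinAt (fun c => Φ c x) (Ici (T x)) (T x)) {a b : ℝ} (hab : a < b)
    (hfin : μ (T ⁻¹' Ioc a b) ≠ ∞) :
    Tendsto (fun n : ℕ => ∑ j ∈ Finset.range (n + 1),
        ∫⁻ x in T ⁻¹' Ioc (a + j * ((b - a) / (n + 1))) (a + (j + 1) * ((b - a) / (n + 1))),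
          Φ (a + (j + 1) * ((b - a) / (n + 1))) x ∂μ)
      atTop (𝓝 (∫⁻ x in T ⁻¹' Ioc a b, Φ (T x) x ∂μ)) := by
  set δ : ℕ → ℝ := fun n => (b - a) / (n + 1) with hδdef
  have hδ : ∀ n, 0 < δ n := fun n => div_pos (sub_pos.2 hab) (by positivity)
  have hδlim : Tendsto δ atTop (𝓝 0) := by
    have := (tendsto_one_div_add_atTop_nhds_zero_nat (𝕜 := ℝ)).const_mul (b - a)
    rw [mul_zero] at this
    refine this.congr fun n => ?_
    rw [hδdef, mul_one_div]
  let C : ℕ → ℕ → Set α := fun n j => T ⁻¹' Ioc (a + j * δ n) (a + (j + 1) * δ n)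
  have hC : ∀ n j, MeasurableSet (C n j) := fun n j => hT measurableSet_Ioc
  let F : ℕ → α → ℝ≥0∞ := fun n x =>
    ∑ j ∈ Finset.range (n + 1), (C n j).indicator (Φ (a + (j + 1) * δ n)) x
  have hFm : ∀ n, Measurable (F n) := fun n =>
    Finset.measurable_sum _ fun j _ => (hΦm _).indicator (hC n j)
  have hsum : ∀ n, ∑ j ∈ Finset.range (n + 1), ∫⁻ x in C n j, Φ (a + (j + 1) * δ n) x ∂μ
      = ∫⁻ x, F n x ∂μ := by
    intro n
    rw [lintegral_finsetSum _ fun j _ => (hΦm _).indicator (hC n j)]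
    exact Finset.sum_congr rfl fun j _ => (lintegral_indicator (hC n j) _).symm
  have hend : ∀ n, a + (n + 1) * δ n = b := by
    intro n
    have : (n : ℝ) + 1 ≠ 0 := by positivity
    rw [hδdef, mul_div_cancel₀ _ this]
    ring
  have hout : ∀ n x, x ∉ T ⁻¹' Ioc a b → F n x = 0 := by
    intro n x hx
    refine Finset.sum_eq_zero fun j hj => indicator_of_notMem (fun hxj => hx ?_) _
    have hjn : (j : ℝ) + 1 ≤ n + 1 := by exact_mod_cast Nat.succ_le_of_lt (Finset.mem_range.1 hj)
    refine ⟨lt_of_le_of_lt ?_ hxj.1, hxj.2.trans ?_⟩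
    · have := mul_nonneg j.cast_nonneg (hδ n).le (α := ℝ)
      linarith
    · rw [← hend n]
      have := mul_le_mul_of_nonneg_right hjn (hδ n).le
      linarith
  have hin : ∀ n x, x ∈ T ⁻¹' Ioc a b →
      ∃ c, T x ≤ c ∧ c ≤ T x + δ n ∧ F n x = Φ c x := by
    intro n x hx
    have hpos : 0 < (T x - a) / δ n := div_pos (sub_pos.2 hx.1) (hδ n)
    have hc0 : 0 < ⌈(T x - a) / δ n⌉₊ := Nat.ceil_pos.2 hpos
    obtain ⟨j, hj⟩ : ∃ j, ⌈(T x - a) / δ n⌉₊ = j + 1 := ⟨⌈(T x - a) / δ n⌉₊ - 1, by omega⟩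
    obtain ⟨hj1, hj2⟩ := (Nat.ceil_eq_iff (Nat.succ_ne_zero j)).1 hj
    simp only [Nat.succ_sub_one, Nat.succ_eq_add_one, Nat.cast_add, Nat.cast_one] at hj1 hj2
    rw [lt_div_iff₀ (hδ n)] at hj1
    rw [div_le_iff₀ (hδ n)] at hj2
    have hmem : x ∈ C n j := ⟨by linarith, by linarith⟩
    refine ⟨a + (j + 1) * δ n, hmem.2, by linarith, ?_⟩
    have hjn : j ∈ Finset.range (n + 1) := by
      rw [Finset.mem_range]
      have h1 : (j : ℝ) * δ n < (n + 1) * δ n := by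
        have := hx.2
        rw [← hend n] at this
        linarith
      have h2 := lt_of_mul_lt_mul_right h1 (hδ n).le
      exact_mod_cast h2
    have huniq : ∀ i ∈ Finset.range (n + 1), i ≠ j →
        (C n i).indicator (Φ (a + (i + 1) * δ n)) x = 0 := by
      intro i _ hij
      refine indicator_of_notMem (fun hxi => hij ?_) _
      have h1 : (i : ℝ) * δ n < (j + 1) * δ n := by linarith [hxi.1, hmem.2]
      have h2 : (j : ℝ) * δ n < (i + 1) * δ n := by linarith [hxi.2, hmem.1]
      have h3 := lt_of_mul_lt_mul_right h1 (hδ n).le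
      have h4 := lt_of_mul_lt_mul_right h2 (hδ n).le
      have h5 : i < j + 1 := by exact_mod_cast h3
      have h6 : j < i + 1 := by exact_mod_cast h4
      omega
    change ∑ i ∈ Finset.range (n + 1), (C n i).indicator (Φ (a + (i + 1) * δ n)) x = _
    rw [Finset.sum_eq_single_of_mem j hjn huniq, indicator_of_mem hmem]
  have hab' : MeasurableSet (T ⁻¹' Ioc a b) := hT measurableSet_Ioc
  rw [← lintegral_indicator hab']
  refine Tendsto.congr (fun n => (hsum n).symm) ?_
  refine tendsto_lintegral_of_dominated_convergence ((T ⁻¹' Ioc a b).indicator 1)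
    hFm (fun n => ae_of_all _ fun x => ?_) ?_ (ae_of_all _ fun x => ?_)
  · by_cases hx : x ∈ T ⁻¹' Ioc a b
    · obtain ⟨c, _, _, hc⟩ := hin n x hx
      rw [hc, indicator_of_mem hx]
      exact hΦ1 c x
    · rw [hout n x hx]
      exact zero_le
  · rwa [lintegral_indicator_one hab']
  · by_cases hx : x ∈ T ⁻¹' Ioc a b
    · rw [indicator_of_mem hx]
      choose c hc1 hc2 hc3 using fun n => hin n x hx
      simp_rw [hc3]
      have hlim : Tendsto c atTop (𝓝 (T x)) :=
        tendsto_of_tendsto_of_tendsto_of_le_of_le tendsto_const_nhds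
          (by simpa using hδlim.const_add (T x)) hc1 hc2
      exact (hΦc x).tendsto.comp
        (tendsto_nhdsWithin_iff.2 ⟨hlim, Eventually.of_forall hc1⟩)
    · rw [indicator_of_notMem hx]
      simp_rw [hout _ x hx]
      exact tendsto_const_nhds

/-- Two grid approximations that agree cell by cell have the same limit. -/
theorem setLIntegral_eq_of_grid {α β : Type*} [MeasurableSpace α] [MeasurableSpace β]
    {μ : Measure α} {ν : Measure β} {T : α → ℝ} {U : β → ℝ} (hT : Measurable T)
    (hU : Measurable U) {Φ : ℝ → α → ℝ≥0∞} {Ψ : ℝ → β → ℝ≥0∞} (hΦm : ∀ c, Measurable (Φ c))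
    (hΨm : ∀ c, Measurable (Ψ c)) (hΦ1 : ∀ c x, Φ c x ≤ 1) (hΨ1 : ∀ c x, Ψ c x ≤ 1)
    (hΦc : ∀ x, ContinuousWithinAt (fun c => Φ c x) (Ici (T x)) (T x))
    (hΨc : ∀ x, ContinuousWithinAt (fun c => Ψ c x) (Ici (U x)) (U x)) {a b : ℝ} (hab : a < b)
    (hμ : μ (T ⁻¹' Ioc a b) ≠ ∞) (hν : ν (U ⁻¹' Ioc a b) ≠ ∞)
    (h : ∀ c c', c < c' →
      ∫⁻ x in T ⁻¹' Ioc c c', Φ c' x ∂μ = ∫⁻ x in U ⁻¹' Ioc c c', Ψ c' x ∂ν) :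
    ∫⁻ x in T ⁻¹' Ioc a b, Φ (T x) x ∂μ = ∫⁻ x in U ⁻¹' Ioc a b, Ψ (U x) x ∂ν := by
  refine tendsto_nhds_unique (tendsto_sum_grid hT hΦm hΦ1 hΦc hab hμ)
    ((tendsto_sum_grid hU hΨm hΨ1 hΨc hab hν).congr fun n =>
      Finset.sum_congr rfl fun j _ => (h _ _ ?_).symm)
  have : 0 < (b - a) / ((n : ℝ) + 1) := div_pos (sub_pos.2 hab) (by positivity)
  linarith

/-! ### Sums over the points beyond a given distance -/

/-- The sum of `h` over the marked points `(d i, y i)` with `c < d i`. -/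
noncomputable def tailSum (h : ℝ × ℝ → ℝ≥0∞) (d y : ℕ → ℝ) (c : ℝ) : ℝ≥0∞ :=
  ∑' i, (Ioi c).indicator (fun r => h (r, y i)) (d i)

lemma antitone_tailSum (h : ℝ × ℝ → ℝ≥0∞) (d y : ℕ → ℝ) : Antitone (tailSum h d y) :=
  fun _ _ hcc => ENNReal.tsum_le_tsum fun _ =>
    indicator_le_indicator_of_subset (Ioi_subset_Ioi hcc) (fun _ => zero_le) _

lemma continuousWithinAt_tailSum (h : ℝ × ℝ → ℝ≥0∞) (d y : ℕ → ℝ) (u : ℝ) :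
    ContinuousWithinAt (tailSum h d y) (Ici u) u := by
  refine continuousWithinAt_Ici_of_antitone (antitone_tailSum h d y) fun z hz => ?_
  -- A finite partial sum already exceeds `z`, and a finite set of points beyond `u` remains beyond
  -- every `c` slightly larger than `u`.
  rw [tailSum, ENNReal.tsum_eq_iSup_sum, lt_iSup_iff] at hz
  obtain ⟨s, hs⟩ := hz
  have h1 : ∀ᶠ c in 𝓝[>] u, ∀ i ∈ s, u < d i → c < d i := by
    rw [eventually_all_finset]
    intro i _
    by_cases hi : u < d i
    · filter_upwards [nhdsWithin_le_nhds (Iio_mem_nhds hi)] with c hc _ using hc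
    · exact Eventually.of_forall fun c hc => absurd hc hi
  obtain ⟨c, hc, hcu⟩ := (h1.and self_mem_nhdsWithin).exists
  refine ⟨c, hcu, hs.trans_le ((Finset.sum_le_sum fun i hi => ?_).trans (ENNReal.sum_le_tsum s))⟩
  by_cases hd : u < d i
  · rw [indicator_of_mem (show d i ∈ Ioi u from hd),
      indicator_of_mem (show d i ∈ Ioi c from hc i hi hd)]
  · rw [indicator_of_notMem (show d i ∉ Ioi u from hd)]
    exact zero_le

lemma measurable_tailSum {Ω : Type*} [MeasurableSpace Ω] {Y G : ℕ → Ω → ℝ}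
    (hY : ∀ i, Measurable (Y i)) (hG : ∀ i, Measurable (G i)) {h : ℝ × ℝ → ℝ≥0∞}
    (hh : Measurable h) {T : Ω → ℝ} (hT : Measurable T) :
    Measurable fun ω => tailSum h (fun i => |Y i ω|) (fun i => G i ω) (T ω) := by
  refine Measurable.tsum fun i => ?_
  have hm : Measurable ({ω | T ω < |Y i ω|}.indicator fun ω => h (|Y i ω|, G i ω)) :=
    Measurable.indicator (hh.comp ((hY i).abs.prodMk (hG i))) (measurableSet_lt hT (hY i).abs)
  convert hm using 1
  funext ω
  simp only [indicator, mem_Ioi, mem_ofPred_eq]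

/-- The probability that a point at distance `r` is lost when a mark `x` is kept with probability
`exp (-h (r, x))`. -/
noncomputable def lossProb (ρ : Measure ℝ) (h : ℝ × ℝ → ℝ≥0∞) (r : ℝ) : ℝ≥0∞ :=
  1 - ∫⁻ x, expNeg (h (r, x)) ∂ρ

/-- The Laplace functional of the points beyond `c`. -/
noncomputable def tailLaplace (L : ℝ) (ρ : Measure ℝ) (h : ℝ × ℝ → ℝ≥0∞) (c : ℝ) : ℝ≥0∞ :=
  expNeg (ENNReal.ofReal L * ∫⁻ r in Ioi c, lossProb ρ h r)

lemma continuousWithinAt_tailLaplace (L : ℝ) (ρ : Measure ℝ) (h : ℝ × ℝ → ℝ≥0∞) (u : ℝ) :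
    ContinuousWithinAt (tailLaplace L ρ h) (Ici u) u := by
  have h1 : ContinuousWithinAt (fun c => ∫⁻ r in Ioi c, lossProb ρ h r) (Ici u) u := by
    refine continuousWithinAt_Ici_of_antitone
      (fun c c' hcc => lintegral_mono_set (Ioi_subset_Ioi hcc)) fun y hy => ?_
    -- Right continuity is continuity from below of this measure along `Ioi (u + 1 / (n + 1))`,
    -- increasing to `Ioi u`; it does not need the measure to be finite.
    set m := volume.withDensity (lossProb ρ h) with hm
    have hm1 : ∀ c, ∫⁻ r in Ioi c, lossProb ρ h r = m (Ioi c) := fun c =>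
      (withDensity_apply _ measurableSet_Ioi).symm
    simp_rw [hm1] at hy ⊢
    have hU : Ioi u = ⋃ n : ℕ, Ioi (u + 1 / ((n : ℝ) + 1)) := by
      ext x
      simp only [mem_Ioi, mem_iUnion]
      constructor
      · intro hx
        obtain ⟨n, hn⟩ := exists_nat_one_div_lt (sub_pos.2 hx)
        exact ⟨n, by linarith⟩
      · rintro ⟨n, hn⟩
        have : (0 : ℝ) < 1 / ((n : ℝ) + 1) := by positivity
        linarith
    have hmono : Monotone fun n : ℕ => Ioi (u + 1 / ((n : ℝ) + 1)) := by
      intro n n' hn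
      refine Ioi_subset_Ioi ?_
      gcongr
    rw [hU, hmono.measure_iUnion, lt_iSup_iff] at hy
    obtain ⟨n, hn⟩ := hy
    exact ⟨_, by have : (0 : ℝ) < 1 / ((n : ℝ) + 1) := by positivity
                 linarith, hn⟩
  exact (continuous_expNeg.tendsto _).comp
    (ENNReal.Tendsto.const_mul h1 (Or.inr ENNReal.ofReal_ne_top))

lemma measurable_tailLaplace {L : ℝ} (ρ : Measure ℝ) (h : ℝ × ℝ → ℝ≥0∞) :
    Measurable (tailLaplace L ρ h) :=
  Monotone.measurable fun _ _ hcc => antitone_expNeg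
    (mul_le_mul_right (lintegral_mono_set (Ioi_subset_Ioi hcc)) _)

/-- The functional that forbids points up to distance `a` and sums `h` beyond `b`. -/
noncomputable def gapped (h : ℝ × ℝ → ℝ≥0∞) (a b : ℝ) (p : ℝ × ℝ) : ℝ≥0∞ :=
  (Iic a).indicator (fun _ => ∞) p.1 + (Ioi b).indicator (fun r => h (r, p.2)) p.1

lemma measurable_gapped {h : ℝ × ℝ → ℝ≥0∞} (hh : Measurable h) (a b : ℝ) :
    Measurable (gapped h a b) := by
  refine ((measurable_const.indicator measurableSet_Iic).comp measurable_fst).add ?_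
  have hm : Measurable ((Prod.fst ⁻¹' Ioi b).indicator h : ℝ × ℝ → ℝ≥0∞) :=
    hh.indicator (measurable_fst measurableSet_Ioi)
  convert hm using 1
  funext p
  simp only [indicator, mem_Ioi, mem_preimage]

/-- A point in `(orderStat d k, a]` makes the sum infinite and the weight `0`; otherwise the gap
contributes nothing. -/
lemma expNeg_tailSum_gapped {d : ℕ → ℝ} (hd : IsSimpleConfig d) (y : ℕ → ℝ)
    (h : ℝ × ℝ → ℝ≥0∞) (k : ℕ) (a b : ℝ) :
    expNeg (tailSum (gapped h a b) d y (orderStat d k))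
      = (if a < orderStat d (k + 1) then 1 else 0)
        * expNeg (tailSum h d y (max b (orderStat d k))) := by
  split_ifs with ha
  · rw [one_mul]
    congr 1
    refine tsum_congr fun i => ?_
    by_cases hi : orderStat d k < d i
    · have hai := (hd.lt_orderStat_succ_iff k a).1 ha i hi
      rw [indicator_of_mem (show d i ∈ Ioi _ from hi), gapped,
        indicator_of_notMem (show d i ∉ Iic a from not_le.2 hai), zero_add]
      by_cases hb : b < d i
      · rw [indicator_of_mem (show d i ∈ Ioi b from hb),
          indicator_of_mem (show d i ∈ Ioi _ from max_lt hb hi)]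
      · rw [indicator_of_notMem (show d i ∉ Ioi b from hb), indicator_of_notMem]
        exact fun h' => hb ((le_max_left _ _).trans_lt h')
    · rw [indicator_of_notMem (show d i ∉ Ioi _ from hi), indicator_of_notMem]
      exact fun h' => hi ((le_max_right _ _).trans_lt h')
  · rw [hd.lt_orderStat_succ_iff] at ha
    push Not at ha
    obtain ⟨i, hi, hia⟩ := ha
    have : tailSum (gapped h a b) d y (orderStat d k) = ∞ := by
      refine ENNReal.tsum_eq_top_of_eq_top ⟨i, ?_⟩
      rw [indicator_of_mem (show d i ∈ Ioi _ from hi), gapped,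
        indicator_of_mem (show d i ∈ Iic a from hia), top_add]
    rw [this, expNeg_top, zero_mul]

lemma tailLaplace_gapped {L : ℝ} {ρ : Measure ℝ} [IsProbabilityMeasure ρ] {h : ℝ × ℝ → ℝ≥0∞}
    {a b : ℝ} (hab : a ≤ b) (x : ℝ) :
    tailLaplace L ρ (gapped h a b) x
      = expNeg (ENNReal.ofReal L * ENNReal.ofReal (a - x)) * tailLaplace L ρ h (max b x) := by
  have h1 : ∀ r, lossProb ρ (gapped h a b) r
      = (Iic a).indicator 1 r + (Ioi b).indicator (lossProb ρ h) r := by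
    intro r
    by_cases ha : r ≤ a
    · have hb : r ∉ Ioi b := not_lt.2 (ha.trans hab)
      simp [lossProb, gapped, indicator_of_mem (show r ∈ Iic a from ha), hb]
    · by_cases hb : b < r
      · simp [lossProb, gapped, indicator_of_notMem (show r ∉ Iic a from ha),
          indicator_of_mem (show r ∈ Ioi b from hb)]
      · simp [lossProb, gapped, indicator_of_notMem (show r ∉ Iic a from ha),
          indicator_of_notMem (show r ∉ Ioi b from hb)]
  have h2 : ∫⁻ r in Ioi x, lossProb ρ (gapped h a b) r
      = ENNReal.ofReal (a - x) + ∫⁻ r in Ioi (max b x), lossProb ρ h r := by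
    simp_rw [h1]
    rw [lintegral_add_left (measurable_one.indicator measurableSet_Iic),
      lintegral_indicator_one measurableSet_Iic, lintegral_indicator measurableSet_Ioi,
      Measure.restrict_apply measurableSet_Iic, Measure.restrict_restrict measurableSet_Ioi,
      Iic_inter_Ioi, Real.volume_Ioc, Ioi_inter_Ioi]
  rw [tailLaplace, h2, mul_add, expNeg_add, tailLaplace]

/-- The waiting time beyond `x` is exponential of rate `L`: the drop of its survival function from
`c` to `c'` is the integral of its density. The additive form avoids truncated subtraction. -/
lemma expNeg_eq_add_setLIntegral {L : ℝ} (hL : 0 ≤ L) (x : ℝ) {c c' : ℝ} (hcc : c ≤ c') :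
    expNeg (ENNReal.ofReal L * ENNReal.ofReal (c - x))
      = expNeg (ENNReal.ofReal L * ENNReal.ofReal (c' - x))
        + ∫⁻ u in Ioc c c' ∩ Ioi x, ENNReal.ofReal (L * Real.exp (-(L * (u - x)))) := by
  have hset : Ioc c c' ∩ Ioi x = Ioc (max c x) c' := by
    rw [← Ioi_inter_Iic, ← Ioi_inter_Iic, ← Ioi_inter_Ioi]
    ac_rfl
  have hE : ∀ a : ℝ, expNeg (ENNReal.ofReal L * ENNReal.ofReal (a - x))
      = ENNReal.ofReal (Real.exp (-(L * (max a x - x)))) := by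
    intro a
    rw [← ENNReal.ofReal_mul hL]
    rcases le_total a x with h | h
    · rw [max_eq_right h, ENNReal.ofReal_of_nonpos (mul_nonpos_of_nonneg_of_nonpos hL (by linarith))]
      simp
    · rw [max_eq_left h, expNeg_ofReal (mul_nonneg hL (by linarith))]
  rw [hset, hE, hE]
  rcases le_or_gt (max c x) c' with h | h
  · have hc' : max c' x = c' := max_eq_left ((le_max_right c x).trans h)
    rw [hc', ← ofReal_integral_eq_lintegral_ofReal
      ((by fun_prop : Continuous fun u => L * Real.exp (-(L * (u - x)))).integrableOn_Ioc)
      (ae_of_all _ fun u => by positivity),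
      ← intervalIntegral.integral_of_le h]
    have hint : ∫ u in (max c x)..c', L * Real.exp (-(L * (u - x)))
        = -Real.exp (-(L * (c' - x))) - -Real.exp (-(L * (max c x - x))) := by
      refine intervalIntegral.integral_eq_sub_of_hasDerivAt
        (f := fun u => -Real.exp (-(L * (u - x)))) (fun u _ => ?_)
        ((by fun_prop : Continuous fun u => L * Real.exp (-(L * (u - x)))).intervalIntegrable _ _)
      have h0 : HasDerivAt (fun u => -(L * (u - x))) (-(L * 1)) u :=
        (((hasDerivAt_id u).sub_const x).const_mul L).neg
      have h1 : HasDerivAt (fun u => -Real.exp (-(L * (u - x))))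
          (-(Real.exp (-(L * (u - x))) * -(L * 1))) u := h0.exp.neg
      refine h1.congr_deriv ?_
      ring
    rw [hint, ← ENNReal.ofReal_add (Real.exp_pos _).le]
    · congr 1
      ring
    · have : Real.exp (-(L * (c' - x))) ≤ Real.exp (-(L * (max c x - x))) :=
        Real.exp_le_exp.2 (neg_le_neg (mul_le_mul_of_nonneg_left (by linarith) hL))
      linarith
  · have hx : c' < x := by
      rcases lt_max_iff.1 h with h | h
      · exact absurd hcc (not_le.2 h)
      · exact h
    rw [Ioc_eq_empty (not_lt.2 h.le), Measure.restrict_empty, lintegral_zero_measure, add_zero,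
      max_eq_right hx.le, max_eq_right (hcc.trans hx.le)]

/-! ### The joint law of the nearest distances and the points beyond them -/

/-- The last coordinate of a vector, with value `0` for the empty vector. -/
def lastCoord : (k : ℕ) → (Fin k → ℝ) → ℝ
  | 0, _ => 0
  | k + 1, x => x (Fin.last k)

lemma measurable_lastCoord : ∀ k, Measurable (lastCoord k)
  | 0 => measurable_const
  | k + 1 => measurable_pi_apply (Fin.last k)

lemma lastCoord_dists {Ω : Type*} (Y : ℕ → Ω → ℝ) (k : ℕ) (ω : Ω) :
    lastCoord k (dists Y k ω) = orderStat (fun i => |Y i ω|) k := by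
  cases k <;> rfl

lemma measurableSet_orderedRegion (k : ℕ) : MeasurableSet (orderedRegion k) := by
  have h : orderedRegion k = (⋂ i, {x : Fin k → ℝ | 0 < x i}) ∩
      ⋂ i, ⋂ j, {x : Fin k → ℝ | i < j → x i < x j} := by
    ext x
    simp only [orderedRegion, mem_ofPred_eq, mem_inter_iff, mem_iInter]
    exact and_congr_right fun _ => ⟨fun hx i j hij => hx hij, fun hx i j hij => hx i j hij⟩
  rw [h]
  refine (MeasurableSet.iInter fun i => measurableSet_lt measurable_const
    (measurable_pi_apply i)).inter (MeasurableSet.iInter fun i => MeasurableSet.iInter fun j => ?_)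
  by_cases hij : i < j
  · simpa [hij] using measurableSet_lt (measurable_pi_apply (X := fun _ : Fin k => ℝ) i)
      (measurable_pi_apply j)
  · simp [hij]

/-- Splitting off the last coordinate. -/
def splitLast (k : ℕ) : (Fin (k + 1) → ℝ) ≃ᵐ ℝ × (Fin k → ℝ) :=
  MeasurableEquiv.piFinSuccAbove (fun _ => ℝ) (Fin.last k)

lemma splitLast_apply (k : ℕ) (x : Fin (k + 1) → ℝ) :
    splitLast k x = (x (Fin.last k), fun j => x j.castSucc) := by
  refine Prod.ext rfl (funext fun j => ?_)
  change x ((Fin.last k).succAbove j) = _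
  rw [Fin.succAbove_last]

lemma measurePreserving_splitLast (k : ℕ) : MeasurePreserving (splitLast k) :=
  volume_preserving_piFinSuccAbove (fun _ => ℝ) (Fin.last k)

/-- The image of the ordered region under `splitLast`. -/
def splitRegion (k : ℕ) : Set (ℝ × (Fin k → ℝ)) :=
  {p | p.2 ∈ orderedRegion k ∧ lastCoord k p.2 < p.1}

lemma measurableSet_splitRegion (k : ℕ) : MeasurableSet (splitRegion k) :=
  (measurable_snd (measurableSet_orderedRegion k)).inter
    (measurableSet_lt ((measurable_lastCoord k).comp measurable_snd) measurable_fst)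

lemma splitLast_preimage_splitRegion (k : ℕ) :
    splitLast k ⁻¹' splitRegion k = orderedRegion (k + 1) := by
  ext x
  simp only [mem_preimage, splitLast_apply, splitRegion, orderedRegion, mem_ofPred_eq]
  constructor
  · rintro ⟨⟨hpos, hmono⟩, hlast⟩
    have hlt : ∀ j : Fin k, x j.castSucc < x (Fin.last k) := by
      intro j
      cases k with
      | zero => exact j.elim0
      | succ k =>
        refine lt_of_le_of_lt ?_ hlast
        exact hmono.monotone (Fin.le_last j)
    have hl : 0 < x (Fin.last k) := by
      cases k with
      | zero => exact hlast
      | succ k => exact (hpos 0).trans (hlt 0)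
    refine ⟨fun i => ?_, fun i j hij => ?_⟩
    · induction i using Fin.lastCases with
      | last => exact hl
      | cast i => exact hpos i
    · induction j using Fin.lastCases with
      | last =>
        obtain ⟨i', rfl⟩ := Fin.exists_castSucc_eq.2 hij.ne
        exact hlt i'
      | cast j =>
        obtain ⟨i', rfl⟩ := Fin.exists_castSucc_eq.2 (hij.trans (Fin.castSucc_lt_last j)).ne
        exact hmono (Fin.castSucc_lt_castSucc_iff.1 hij)
  · rintro ⟨hpos, hmono⟩
    refine ⟨⟨fun i => hpos _, fun i j hij => hmono (Fin.castSucc_lt_castSucc_iff.2 hij)⟩, ?_⟩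
    cases k with
    | zero => exact hpos _
    | succ k => exact hmono (Fin.castSucc_lt_last _)

/-- The law of the `k + 1` smallest distances of a Poisson process of rate `L`, with the last
coordinate split off. -/
noncomputable def splitLaw (L : ℝ) (k : ℕ) : Measure (ℝ × (Fin k → ℝ)) :=
  (volume.restrict (splitRegion k)).withDensity
    fun p => ENNReal.ofReal (L ^ (k + 1) * Real.exp (-(L * p.1)))

lemma setLIntegral_splitLaw {L : ℝ} {k : ℕ} {F : ℝ → ℝ≥0∞} (hF : Measurable F) {s : Set ℝ}
    (hs : MeasurableSet s) {A : Set (Fin k → ℝ)} (hA : MeasurableSet A) :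
    ∫⁻ p in s ×ˢ A, F p.1 ∂splitLaw L k
      = ∫⁻ x in A ∩ orderedRegion k, ∫⁻ u in s ∩ Ioi (lastCoord k x),
          ENNReal.ofReal (L ^ (k + 1) * Real.exp (-(L * u))) * F u := by
  have hD : Measurable fun p : ℝ × (Fin k → ℝ) =>
      ENNReal.ofReal (L ^ (k + 1) * Real.exp (-(L * p.1))) := by fun_prop
  have hF' : Measurable fun p : ℝ × (Fin k → ℝ) => F p.1 := hF.comp measurable_fst
  have hsA := hs.prod hA
  rw [splitLaw, setLIntegral_withDensity_eq_setLIntegral_mul _ hD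
      hF' hsA,
    Measure.restrict_restrict hsA, ← lintegral_indicator (hsA.inter (measurableSet_splitRegion k)),
    Measure.volume_eq_prod, lintegral_prod_symm _
      (Measurable.indicator (hD.mul hF') (hsA.inter (measurableSet_splitRegion k))).aemeasurable,
    ← lintegral_indicator (hA.inter (measurableSet_orderedRegion k))]
  refine lintegral_congr fun x => ?_
  by_cases hx : x ∈ A ∩ orderedRegion k
  · rw [indicator_of_mem hx, ← lintegral_indicator (hs.inter measurableSet_Ioi)]
    refine lintegral_congr fun u => ?_
    by_cases hu : u ∈ s ∩ Ioi (lastCoord k x)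
    · rw [indicator_of_mem hu, indicator_of_mem]
      · rfl
      · exact ⟨⟨hu.1, hx.1⟩, hx.2, hu.2⟩
    · rw [indicator_of_notMem hu, indicator_of_notMem]
      exact fun h => hu ⟨h.1.1, h.2.2⟩
  · rw [indicator_of_notMem hx]
    refine (lintegral_congr fun u => ?_).trans lintegral_zero
    exact indicator_of_notMem (fun h => hx ⟨h.1.2, h.2.1⟩) _

/-! ### Induction on the number of nearest distances. -/

namespace IsRadialPoisson

variable {Ω : Type*} [MeasurableSpace Ω] {P : Measure Ω} {L : ℝ} {ρ : Measure ℝ}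
  {Y G : ℕ → Ω → ℝ}

/-- The weight `exp (-∑ h)` over the points of a configuration beyond `c`. -/
noncomputable def tailWeight (Y G : ℕ → Ω → ℝ) (h : ℝ × ℝ → ℝ≥0∞) (c : ℝ) (ω : Ω) : ℝ≥0∞ :=
  expNeg (tailSum h (fun i => |Y i ω|) (fun i => G i ω) c)

lemma measurable_tailWeight (hY : IsRadialPoisson P L ρ Y G) {h : ℝ × ℝ → ℝ≥0∞}
    (hh : Measurable h) {T : Ω → ℝ} (hT : Measurable T) :
    Measurable fun ω => tailWeight Y G h (T ω) ω :=
  measurable_expNeg.comp (measurable_tailSum hY.measurable_Y hY.measurable_G hh hT)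

/-- The joint law of the `k` smallest distances and the points beyond them. -/
def HasTailLaw (P : Measure Ω) (L : ℝ) (ρ : Measure ℝ) (Y G : ℕ → Ω → ℝ) (k : ℕ) : Prop :=
  ∀ h : ℝ × ℝ → ℝ≥0∞, Measurable h → ∀ A : Set (Fin k → ℝ), MeasurableSet A →
    ∫⁻ ω in dists Y k ⁻¹' A, tailWeight Y G h (lastCoord k (dists Y k ω)) ω ∂P
      = ∫⁻ x in A ∩ orderedRegion k, ENNReal.ofReal (L ^ k * Real.exp (-(L * lastCoord k x)))
          * tailLaplace L ρ h (lastCoord k x)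

lemma hasTailLaw_zero (hY : IsRadialPoisson P L ρ Y G) : HasTailLaw P L ρ Y G 0 := by
  intro h hh A _
  have hm : Measurable ((Prod.fst ⁻¹' Ioi 0).indicator h : ℝ × ℝ → ℝ≥0∞) :=
    hh.indicator (measurable_fst measurableSet_Ioi)
  have h1 := hY.laplace _ hm
  have h2 : ∫⁻ r in Ioi 0, (1 - ∫⁻ x, expNeg ((Prod.fst ⁻¹' Ioi 0).indicator h (r, x)) ∂ρ)
      = ∫⁻ r in Ioi 0, lossProb ρ h r :=
    setLIntegral_congr_fun measurableSet_Ioi fun r hr => by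
      simp only [lossProb, indicator_of_mem (show (r, _) ∈ Prod.fst ⁻¹' Ioi (0 : ℝ) from hr)]
  rw [h2] at h1
  have hord : orderedRegion 0 = univ :=
    eq_univ_of_forall fun x => ⟨fun i => i.elim0, fun i => i.elim0⟩
  have hW : ∫⁻ ω, tailWeight Y G h 0 ω ∂P = tailLaplace L ρ h 0 := h1
  rcases Subsingleton.eq_empty_or_singleton (s := A) subsingleton_of_subsingleton with hA | ⟨a, hA⟩
  · simp [hA]
  · have hA' : A = univ := by
      rw [hA]
      exact eq_univ_of_forall fun x => Subsingleton.elim _ _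
    rw [hA', preimage_univ, univ_inter, hord, Measure.restrict_univ, Measure.restrict_univ]
    simp only [lastCoord, hW, pow_zero, mul_zero, neg_zero, Real.exp_zero, mul_one,
      ENNReal.ofReal_one, one_mul, lintegral_const]
    -- The space of vectors indexed by `Fin 0` is a single point of volume `1`.
    simp [volume_pi]

variable [IsProbabilityMeasure P] [IsProbabilityMeasure ρ]

lemma setLIntegral_tailWeight_Ioc (hY : IsRadialPoisson P L ρ Y G) (hL : 0 ≤ L) {k : ℕ}
    (hk : HasTailLaw P L ρ Y G k) {h : ℝ × ℝ → ℝ≥0∞} (hh : Measurable h) {A : Set (Fin k → ℝ)}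
    (hA : MeasurableSet A) {c c' : ℝ} (hcc : c ≤ c') :
    ∫⁻ ω in dists Y k ⁻¹' A ∩ nthDist Y k ⁻¹' Ioc c c', tailWeight Y G h c' ω ∂P
      = ∫⁻ _ in Ioc c c' ×ˢ A, tailLaplace L ρ h c' ∂splitLaw L k := by
  have hT := measurable_nthDist hY.measurable_Y k
  have hlast : Measurable fun ω => lastCoord k (dists Y k ω) :=
    (measurable_lastCoord k).comp (measurable_dists hY.measurable_Y k)
  have hIoc : MeasurableSet (nthDist Y k ⁻¹' Ioc c c') := hT measurableSet_Ioc
  -- Both functionals start summing `h` beyond the same `c'`; they differ only in the forbidden gap,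
  -- hence exactly on the event that the next distance lies in `(c, c']`.
  have hleft : ∀ᵐ ω ∂P, tailWeight Y G (gapped h c c') (lastCoord k (dists Y k ω)) ω
      = tailWeight Y G (gapped h c' c') (lastCoord k (dists Y k ω)) ω
        + (nthDist Y k ⁻¹' Ioc c c').indicator (tailWeight Y G h c') ω := by
    filter_upwards [hY.ae_isSimpleConfig hL] with ω hω
    have hTω : nthDist Y k ω = orderStat (fun i => |Y i ω|) (k + 1) := rfl
    have hlt := hω.orderStat_lt_succ k
    simp only [tailWeight, lastCoord_dists]
    rw [expNeg_tailSum_gapped hω, expNeg_tailSum_gapped hω, ← hTω]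
    by_cases h1 : c < nthDist Y k ω
    · by_cases h2 : c' < nthDist Y k ω
      · rw [indicator_of_notMem (fun h => absurd h.2 (not_le.2 h2)), if_pos h1, if_pos h2, add_zero]
      · rw [indicator_of_mem (show ω ∈ nthDist Y k ⁻¹' Ioc c c' from ⟨h1, not_lt.1 h2⟩), if_pos h1,
          if_neg h2, zero_mul, zero_add, one_mul,
          max_eq_left (hlt.le.trans (hTω ▸ not_lt.1 h2))]
        rfl
    · have h2 : ¬ c' < nthDist Y k ω := fun h => h1 (hcc.trans_lt h)
      rw [indicator_of_notMem (fun h => absurd h.1 h1), if_neg h1, if_neg h2, zero_mul, add_zero]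
  have hright : ∀ x : Fin k → ℝ, ENNReal.ofReal (L ^ k * Real.exp (-(L * lastCoord k x)))
        * tailLaplace L ρ (gapped h c c') (lastCoord k x)
      = ENNReal.ofReal (L ^ k * Real.exp (-(L * lastCoord k x)))
        * tailLaplace L ρ (gapped h c' c') (lastCoord k x)
        + ∫⁻ u in Ioc c c' ∩ Ioi (lastCoord k x),
          ENNReal.ofReal (L ^ (k + 1) * Real.exp (-(L * u))) * tailLaplace L ρ h c' := by
    intro x
    set y := lastCoord k x
    rw [tailLaplace_gapped hcc, tailLaplace_gapped le_rfl, expNeg_eq_add_setLIntegral hL y hcc,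
      add_mul, mul_add]
    congr 1
    rw [← lintegral_mul_const' _ _ (show tailLaplace L ρ h (max c' y) ≠ ∞ from expNeg_ne_top _),
      ← lintegral_const_mul' _ _ ENNReal.ofReal_ne_top]
    refine setLIntegral_congr_fun (measurableSet_Ioc.inter measurableSet_Ioi) fun u hu => ?_
    rw [max_eq_left ((le_of_lt hu.2).trans hu.1.2), ← mul_assoc,
      ← ENNReal.ofReal_mul (by positivity)]
    congr 2
    have : Real.exp (-(L * u)) = Real.exp (-(L * y)) * Real.exp (-(L * (u - y))) := by
      rw [← Real.exp_add]
      congr 1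
      ring
    rw [this]
    ring
  have e1 := hk _ (measurable_gapped hh c c') A hA
  have e2 := hk _ (measurable_gapped hh c' c') A hA
  rw [lintegral_congr_ae (ae_restrict_of_ae hleft),
    lintegral_add_left (hY.measurable_tailWeight (measurable_gapped hh c' c') hlast),
    lintegral_indicator hIoc, Measure.restrict_restrict hIoc, inter_comm, e2] at e1
  simp_rw [hright] at e1
  have hm : Measurable fun x : Fin k → ℝ => ENNReal.ofReal (L ^ k * Real.exp (-(L * lastCoord k x)))
      * tailLaplace L ρ (gapped h c' c') (lastCoord k x) :=
    ((by fun_prop : Measurable fun y : ℝ => ENNReal.ofReal (L ^ k * Real.exp (-(L * y)))).comp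
      (measurable_lastCoord k)).mul
      ((measurable_tailLaplace ρ (gapped h c' c')).comp (measurable_lastCoord k))
  rw [lintegral_add_left hm] at e1
  -- The term common to both expansions must be finite to be cancelled; it is the integral of a
  -- weight at most `1` under a probability.
  have hfin : ∫⁻ x in A ∩ orderedRegion k, ENNReal.ofReal (L ^ k * Real.exp (-(L * lastCoord k x)))
      * tailLaplace L ρ (gapped h c' c') (lastCoord k x) ≠ ∞ := by
    rw [← e2]
    refine ne_top_of_le_ne_top (measure_ne_top P (dists Y k ⁻¹' A)) ?_
    calc _ ≤ ∫⁻ _ in dists Y k ⁻¹' A, 1 ∂P := lintegral_mono fun ω => expNeg_le_one _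
      _ = _ := by simp
  rw [setLIntegral_splitLaw measurable_const measurableSet_Ioc hA]
  exact (ENNReal.add_right_inj hfin).1 e1

lemma hasTailLaw_succ (hY : IsRadialPoisson P L ρ Y G) (hL : 0 ≤ L) {k : ℕ}
    (hk : HasTailLaw P L ρ Y G k) : HasTailLaw P L ρ Y G (k + 1) := by
  intro h hh B hB
  have hT := measurable_nthDist hY.measurable_Y k
  have hdk := measurable_dists hY.measurable_Y k
  have hgrid : ∀ A : Set (Fin k → ℝ), MeasurableSet A → ∀ a b : ℝ, a < b →
      ∫⁻ ω in dists Y k ⁻¹' A ∩ nthDist Y k ⁻¹' Ioc a b, tailWeight Y G h (nthDist Y k ω) ω ∂P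
        = ∫⁻ p in Ioc a b ×ˢ A, tailLaplace L ρ h p.1 ∂splitLaw L k := by
    intro A hA a b hab
    have hprod : ∀ s : Set ℝ, s ×ˢ A = Prod.fst ⁻¹' s ∩ Prod.snd ⁻¹' A := fun s => rfl
    have hfin : splitLaw L k (Ioc a b ×ˢ A) ≠ ∞ := by
      -- For `h = 0` the cell identity equates this mass with a probability.
      have := hY.setLIntegral_tailWeight_Ioc hL hk (h := fun _ => 0) measurable_const hA hab.le
      simp only [tailWeight, tailSum, indicator_zero, tsum_zero, expNeg_zero, tailLaplace, lossProb,
        lintegral_const, measure_univ, mul_one, tsub_self, zero_mul, mul_zero, one_mul,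
        Measure.restrict_apply_univ] at this
      rw [← this]
      exact measure_ne_top _ _
    have hAs : MeasurableSet (Prod.snd ⁻¹' A : Set (ℝ × (Fin k → ℝ))) := measurable_snd hA
    have := setLIntegral_eq_of_grid (μ := P.restrict (dists Y k ⁻¹' A))
      (ν := (splitLaw L k).restrict (Prod.snd ⁻¹' A)) hT measurable_fst
      (Φ := fun c ω => tailWeight Y G h c ω) (Ψ := fun c _ => tailLaplace L ρ h c)
      (fun c => hY.measurable_tailWeight hh measurable_const) (fun c => measurable_const)
      (fun c ω => expNeg_le_one _) (fun c p => expNeg_le_one _)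
      (fun ω => (continuous_expNeg.tendsto _).comp (continuousWithinAt_tailSum h _ _ _))
      (fun p => continuousWithinAt_tailLaplace L ρ h _) hab (measure_ne_top _ _)
      (by rwa [Measure.restrict_apply (measurable_fst measurableSet_Ioc), ← hprod])
      (fun c c' hcc => by
        rw [Measure.restrict_restrict (hT measurableSet_Ioc),
          Measure.restrict_restrict (measurable_fst measurableSet_Ioc), ← hprod, inter_comm]
        exact hY.setLIntegral_tailWeight_Ioc hL hk hh hA hcc.le)
    rwa [Measure.restrict_restrict (hT measurableSet_Ioc),
      Measure.restrict_restrict (measurable_fst measurableSet_Ioc), ← hprod, inter_comm] at this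
  have hW : Measurable fun ω => tailWeight Y G h (nthDist Y k ω) ω := hY.measurable_tailWeight hh hT
  have hpair : Measurable fun ω => (nthDist Y k ω, dists Y k ω) := hT.prodMk hdk
  set μ₁ : Measure (ℝ × (Fin k → ℝ)) :=
    (P.withDensity fun ω => tailWeight Y G h (nthDist Y k ω) ω).map
      fun ω => (nthDist Y k ω, dists Y k ω) with hμ₁
  set μ₂ : Measure (ℝ × (Fin k → ℝ)) := (splitLaw L k).withDensity fun p => tailLaplace L ρ h p.1
    with hμ₂
  have : IsFiniteMeasure (P.withDensity fun ω => tailWeight Y G h (nthDist Y k ω) ω) := by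
    refine isFiniteMeasure_withDensity (ne_top_of_le_ne_top ENNReal.one_ne_top ?_)
    calc _ ≤ ∫⁻ _, 1 ∂P := lintegral_mono fun ω => expNeg_le_one _
      _ = 1 := by simp
  have hrect : ∀ a b : ℝ, a < b → ∀ A : Set (Fin k → ℝ), MeasurableSet A →
      μ₁ (Ioc a b ×ˢ A) = μ₂ (Ioc a b ×ˢ A) := by
    intro a b hab A hA
    have hm := (measurableSet_Ioc (a := a) (b := b)).prod hA
    rw [hμ₁, hμ₂, Measure.map_apply hpair hm, withDensity_apply _ (hpair hm),
      withDensity_apply _ hm, ← hgrid A hA a b hab]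
    congr 2
    exact inter_comm _ _
  have hμ : μ₁ = μ₂ := by
    rw [Measure.ext_prod_iff]
    intro s A hs hA
    -- With `A` fixed, agreement on half-open intervals determines the measure in the first
    -- coordinate, which extends equality to all measurable rectangles.
    have hx : (μ₁.restrict (univ ×ˢ A)).map Prod.fst = (μ₂.restrict (univ ×ˢ A)).map Prod.fst := by
      refine Measure.ext_of_Ioc _ _ fun a b hab => ?_
      rw [Measure.map_apply measurable_fst measurableSet_Ioc,
        Measure.map_apply measurable_fst measurableSet_Ioc,
        Measure.restrict_apply (measurable_fst measurableSet_Ioc),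
        Measure.restrict_apply (measurable_fst measurableSet_Ioc)]
      have : Prod.fst ⁻¹' Ioc a b ∩ univ ×ˢ A = Ioc a b ×ˢ A := by
        ext p
        simp
      rw [this, hrect a b hab A hA]
    have hs' := congrArg (fun m => m s) hx
    rw [Measure.map_apply measurable_fst hs, Measure.map_apply measurable_fst hs,
      Measure.restrict_apply (measurable_fst hs), Measure.restrict_apply (measurable_fst hs)] at hs'
    have : Prod.fst ⁻¹' s ∩ univ ×ˢ A = s ×ˢ A := by
      ext p
      simp
    rwa [this] at hs'
  have hB' : MeasurableSet ((splitLast k).symm ⁻¹' B) := (splitLast k).symm.measurable hB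
  have key := congrArg (fun m => m ((splitLast k).symm ⁻¹' B)) hμ
  have hpre : (fun ω => (nthDist Y k ω, dists Y k ω)) ⁻¹' ((splitLast k).symm ⁻¹' B)
      = dists Y (k + 1) ⁻¹' B := by
    ext ω
    have : (nthDist Y k ω, dists Y k ω) = splitLast k (dists Y (k + 1) ω) := by
      rw [splitLast_apply]
      rfl
    simp only [mem_preimage, this, MeasurableEquiv.symm_apply_apply]
  have hTL : Measurable fun p : ℝ × (Fin k → ℝ) => tailLaplace L ρ h p.1 :=
    (measurable_tailLaplace ρ h).comp measurable_fst
  have hD : Measurable fun p : ℝ × (Fin k → ℝ) =>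
      ENNReal.ofReal (L ^ (k + 1) * Real.exp (-(L * p.1))) := by fun_prop
  rw [hμ₁, hμ₂, Measure.map_apply hpair hB', withDensity_apply _ (hpair hB'), hpre,
    withDensity_apply _ hB', splitLaw,
    setLIntegral_withDensity_eq_setLIntegral_mul _ hD hTL hB', Measure.restrict_restrict hB',
    ← (measurePreserving_splitLast k).setLIntegral_comp_preimage
      (hB'.inter (measurableSet_splitRegion k)) (hD.mul hTL), preimage_inter,
    splitLast_preimage_splitRegion] at key
  have hBB : splitLast k ⁻¹' ((splitLast k).symm ⁻¹' B) = B := by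
    ext x
    simp
  rw [hBB] at key
  exact key

theorem hasTailLaw (hY : IsRadialPoisson P L ρ Y G) (hL : 0 ≤ L) (k : ℕ) :
    HasTailLaw P L ρ Y G k := by
  induction k with
  | zero => exact hY.hasTailLaw_zero
  | succ k ih => exact hY.hasTailLaw_succ hL ih

end IsRadialPoisson

/-! ### Exponential gains and the closed form of the Laplace transform -/

lemma expMeasure_eq_withDensity (mu : ℝ) :
    expMeasure mu = volume.withDensity (exponentialPDF mu) := rfl

lemma measurable_exponentialPDF (mu : ℝ) : Measurable (exponentialPDF mu) :=
  (measurable_exponentialPDFReal mu).ennreal_ofReal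

lemma lintegral_expNeg_expMeasure {mu θ : ℝ} (hmu : 0 < mu) (hθ : 0 ≤ θ) :
    ∫⁻ x, expNeg (ENNReal.ofReal (θ * x)) ∂expMeasure mu = ENNReal.ofReal (mu / (θ + mu)) := by
  have hsum : 0 < θ + mu := by linarith
  have hpt : ∀ x, exponentialPDF mu x * expNeg (ENNReal.ofReal (θ * x))
      = ENNReal.ofReal (mu / (θ + mu)) * exponentialPDF (θ + mu) x := by
    intro x
    rcases lt_or_ge x 0 with hx | hx
    · rw [exponentialPDF_of_neg hx, exponentialPDF_of_neg hx, zero_mul, mul_zero]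
    · rw [exponentialPDF_of_nonneg hx, exponentialPDF_of_nonneg hx,
        expNeg_ofReal (mul_nonneg hθ hx), ← ENNReal.ofReal_mul (by positivity),
        ← ENNReal.ofReal_mul (by positivity), mul_assoc, ← Real.exp_add, ← mul_assoc,
        div_mul_cancel₀ _ hsum.ne']
      congr 3
      ring
  have hm : Measurable fun x : ℝ => expNeg (ENNReal.ofReal (θ * x)) :=
    measurable_expNeg.comp (by fun_prop)
  rw [expMeasure_eq_withDensity, lintegral_withDensity_eq_lintegral_mul _
    (measurable_exponentialPDF mu) hm]
  simp only [Pi.mul_apply, hpt]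
  rw [lintegral_const_mul' _ _ ENNReal.ofReal_ne_top, lintegral_exponentialPDF_eq_one hsum, mul_one]

lemma expMeasure_Ioi {mu a : ℝ} (hmu : 0 < mu) (ha : 0 ≤ a) :
    expMeasure mu (Ioi a) = ENNReal.ofReal (Real.exp (-(mu * a))) := by
  have := isProbabilityMeasure_expMeasure hmu
  have h1 : expMeasure mu (Iic a) = ENNReal.ofReal (1 - Real.exp (-(mu * a))) := by
    rw [expMeasure_eq_withDensity, withDensity_apply _ measurableSet_Iic,
      lintegral_exponentialPDF_eq_antiDeriv hmu, if_pos ha]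
  have hle : Real.exp (-(mu * a)) ≤ 1 := Real.exp_le_one_iff.2 (by nlinarith)
  rw [← compl_Iic, prob_compl_eq_one_sub measurableSet_Iic, h1, ← ENNReal.ofReal_one,
    ← ENNReal.ofReal_sub _ (by linarith)]
  congr 1
  ring

/-- Contribution to the exponent of the Laplace functional of one point with mark `x` at `r`. -/
noncomputable def pathLoss (Pd alpha s : ℝ) (p : ℝ × ℝ) : ℝ≥0∞ :=
  ENNReal.ofReal s * ENNReal.ofReal (Pd * p.2 * p.1 ^ (-alpha))

lemma measurable_pathLoss (Pd alpha s : ℝ) : Measurable (pathLoss Pd alpha s) := by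
  unfold pathLoss
  fun_prop

/-! ### Bounds, continuity and measurability of the closed form. -/

section Zeta

variable {lam mu Pd alpha : ℝ}

lemma one_sub_div_mem_Icc (hmu : 0 < mu) {a : ℝ} (ha : 0 ≤ a) :
    1 - mu / (a + mu) ∈ Icc 0 (a / mu) := by
  have hs : 0 < a + mu := by linarith
  have h : 1 - mu / (a + mu) = a / (a + mu) := by
    field_simp
    ring
  rw [h]
  exact ⟨by positivity, div_le_div_of_nonneg_left ha hmu (by linarith)⟩

lemma measurable_zeta_integrand :
    Measurable fun p : (ℝ × ℝ) × ℝ => 1 - mu / (p.1.1 * Pd * p.2 ^ (-alpha) + mu) := by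
  fun_prop

lemma norm_zeta_integrand_le (hmu : 0 < mu) (hPd : 0 < Pd) {s s' x : ℝ} (hs : 0 ≤ s) (hss : s ≤ s')
    (hx : 0 < x) :
    ‖1 - mu / (s * Pd * x ^ (-alpha) + mu)‖ ≤ s' * Pd / mu * x ^ (-alpha) := by
  have hp : 0 < x ^ (-alpha) := Real.rpow_pos_of_pos hx _
  have h := one_sub_div_mem_Icc hmu (a := s * Pd * x ^ (-alpha)) (by positivity)
  rw [Real.norm_of_nonneg h.1]
  refine h.2.trans ?_
  rw [mul_div_right_comm]
  gcongr

lemma integrableOn_zeta_bound (halpha : 1 < alpha) (c : ℝ) {r : ℝ} (hr : 0 < r) :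
    IntegrableOn (fun x : ℝ => c * x ^ (-alpha)) (Ioi r) :=
  (integrableOn_Ioi_rpow_of_lt (by linarith) hr).const_mul c

lemma integrableOn_zeta_integrand (hmu : 0 < mu) (hPd : 0 < Pd) (halpha : 1 < alpha) {s r : ℝ}
    (hs : 0 ≤ s) (hr : 0 < r) :
    IntegrableOn (fun x : ℝ => 1 - mu / (s * Pd * x ^ (-alpha) + mu)) (Ioi r) := by
  refine Integrable.mono' (integrableOn_zeta_bound halpha (s * Pd / mu) hr)
    (measurable_zeta_integrand.comp (measurable_prodMk_left (x := (s, r)))).aestronglyMeasurable ?_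
  filter_upwards [ae_restrict_mem measurableSet_Ioi] with x hx
  exact norm_zeta_integrand_le hmu hPd hs le_rfl (hr.trans hx)

lemma continuousOn_zeta (hmu : 0 < mu) (hPd : 0 < Pd) (halpha : 1 < alpha) {r : ℝ} (hr : 0 < r) :
    ContinuousOn (fun s => zeta lam mu Pd alpha s r) (Ici 0) := by
  intro s hs
  have h : ContinuousWithinAt (fun s => ∫ x in Ioi r, (1 - mu / (s * Pd * x ^ (-alpha) + mu)))
      (Ici 0) s := by
    refine continuousWithinAt_of_dominated (bound := fun x => (s + 1) * Pd / mu * x ^ (-alpha))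
      (Eventually.of_forall fun s' => (measurable_zeta_integrand.comp
        (measurable_prodMk_left (x := (s', r)))).aestronglyMeasurable) ?_
      (integrableOn_zeta_bound halpha _ hr) ?_
    · filter_upwards [self_mem_nhdsWithin,
        nhdsWithin_le_nhds (Iic_mem_nhds (show s < s + 1 by linarith))] with s' hs' hss
      filter_upwards [ae_restrict_mem measurableSet_Ioi] with x hx
      exact norm_zeta_integrand_le hmu hPd hs' hss (hr.trans hx)
    · filter_upwards [ae_restrict_mem measurableSet_Ioi] with x hx
      have hp : 0 < x ^ (-alpha) := Real.rpow_pos_of_pos (hr.trans hx) _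
      have hpos : s * Pd * x ^ (-alpha) + mu ≠ 0 := by
        have := mul_nonneg (mul_nonneg (show 0 ≤ s from hs) hPd.le) hp.le
        linarith
      refine ContinuousAt.continuousWithinAt ?_
      fun_prop (disch := assumption)
  exact Real.continuous_exp.continuousAt.comp_continuousWithinAt (h.const_mul (2 * lam)).neg

lemma zeta_zero (hmu : 0 < mu) (r : ℝ) : zeta lam mu Pd alpha 0 r = 1 := by
  simp [zeta, hmu.ne']

lemma zeta_nonneg (s r : ℝ) : 0 ≤ zeta lam mu Pd alpha s r := (Real.exp_pos _).le

lemma zeta_le_one (hlam : 0 ≤ lam) (hmu : 0 < mu) (hPd : 0 < Pd) {s r : ℝ} (hs : 0 ≤ s)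
    (hr : 0 < r) : zeta lam mu Pd alpha s r ≤ 1 := by
  refine Real.exp_le_one_iff.2 (neg_nonpos.2 (mul_nonneg (by positivity) ?_))
  refine setIntegral_nonneg measurableSet_Ioi fun x hx => ?_
  have hp : 0 < x ^ (-alpha) := Real.rpow_pos_of_pos (hr.trans hx) _
  exact (one_sub_div_mem_Icc hmu (by positivity)).1

lemma measurable_zeta : Measurable fun p : ℝ × ℝ => zeta lam mu Pd alpha p.1 p.2 := by
  have hset : MeasurableSet {q : (ℝ × ℝ) × ℝ | q.1.2 < q.2} :=
    measurableSet_lt (by fun_prop) (by fun_prop)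
  -- The varying domain `(r, ∞)` is moved into an indicator so that the parameter integral runs over
  -- a fixed space.
  have h1 : StronglyMeasurable ({q : (ℝ × ℝ) × ℝ | q.1.2 < q.2}.indicator
      fun q => 1 - mu / (q.1.1 * Pd * q.2 ^ (-alpha) + mu)) :=
    (measurable_zeta_integrand.indicator hset).stronglyMeasurable
  have h2 := h1.integral_prod_right' (ν := volume)
  have h3 : ∀ p : ℝ × ℝ, ∫ x, {q : (ℝ × ℝ) × ℝ | q.1.2 < q.2}.indicator
      (fun q => 1 - mu / (q.1.1 * Pd * q.2 ^ (-alpha) + mu)) (p, x)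
      = ∫ x in Ioi p.2, (1 - mu / (p.1 * Pd * x ^ (-alpha) + mu)) := by
    intro p
    rw [← integral_indicator measurableSet_Ioi]
    rfl
  simp_rw [h3] at h2
  exact Real.measurable_exp.comp ((h2.measurable.const_mul (2 * lam)).neg)

lemma tailLaplace_pathLoss (hlam : 0 ≤ lam) (hmu : 0 < mu) (hPd : 0 < Pd) (halpha : 1 < alpha)
    {s r : ℝ} (hs : 0 ≤ s) (hr : 0 < r) :
    tailLaplace (2 * lam) (expMeasure mu) (pathLoss Pd alpha s) r
      = ENNReal.ofReal (zeta lam mu Pd alpha s r) := by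
  have h1 : ∀ x ∈ Ioi r, lossProb (expMeasure mu) (pathLoss Pd alpha s) x
      = ENNReal.ofReal (1 - mu / (s * Pd * x ^ (-alpha) + mu)) := by
    intro x hx
    have hp : 0 < x ^ (-alpha) := Real.rpow_pos_of_pos (hr.trans hx) _
    have ha : 0 ≤ s * Pd * x ^ (-alpha) := by positivity
    have h2 : ∀ y, pathLoss Pd alpha s (x, y) = ENNReal.ofReal (s * Pd * x ^ (-alpha) * y) := by
      intro y
      rw [pathLoss, ← ENNReal.ofReal_mul hs]
      congr 1
      ring
    simp_rw [lossProb, h2]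
    rw [lintegral_expNeg_expMeasure hmu ha, ← ENNReal.ofReal_one,
      ← ENNReal.ofReal_sub _ (by positivity)]
  have hnn : 0 ≤ᵐ[volume.restrict (Ioi r)] fun x : ℝ => 1 - mu / (s * Pd * x ^ (-alpha) + mu) := by
    filter_upwards [ae_restrict_mem measurableSet_Ioi] with x hx
    have hp : 0 < x ^ (-alpha) := Real.rpow_pos_of_pos (hr.trans hx) _
    exact (one_sub_div_mem_Icc hmu (by positivity)).1
  rw [tailLaplace, setLIntegral_congr_fun measurableSet_Ioi h1,
    ← ofReal_integral_eq_lintegral_ofReal (integrableOn_zeta_integrand hmu hPd halpha hs hr) hnn,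
    ← ENNReal.ofReal_mul (by positivity),
    expNeg_ofReal (mul_nonneg (by positivity) (integral_nonneg_of_ae hnn)), zeta]

end Zeta

/-! ### The distances and the interference -/

/-- The law of the `m` smallest distances. -/
noncomputable def distLaw (lam : ℝ) (m : ℕ) : Measure (Fin m → ℝ) :=
  (volume.restrict (orderedRegion m)).withDensity
    fun x => ENNReal.ofReal (jointDensity lam m (lastCoord m x))

lemma measurable_jointDensity (lam : ℝ) (m : ℕ) : Measurable (jointDensity lam m) := by
  unfold jointDensity
  fun_prop

lemma jointDensity_pos {lam : ℝ} (hlam : 0 < lam) (m : ℕ) (r : ℝ) : 0 < jointDensity lam m r := by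
  unfold jointDensity
  positivity

lemma lastCoord_pos {m : ℕ} (hm : 0 < m) {x : Fin m → ℝ} (hx : x ∈ orderedRegion m) :
    0 < lastCoord m x := by
  obtain ⟨k, rfl⟩ : ∃ k, m = k + 1 := ⟨m - 1, by omega⟩
  exact hx.1 _

lemma ae_distLaw_mem (lam : ℝ) (m : ℕ) : ∀ᵐ x ∂distLaw lam m, x ∈ orderedRegion m :=
  (withDensity_absolutelyContinuous _ _).ae_le (ae_restrict_mem (measurableSet_orderedRegion m))

/-! ### Law of the distances and conditional law of the interference. -/

namespace IsRadialPoisson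

variable {Ω : Type*} [MeasurableSpace Ω] {P : Measure Ω} [IsProbabilityMeasure P]
  {Y G : ℕ → Ω → ℝ} {lam mu Pd alpha : ℝ} {m : ℕ}

lemma ae_pathLoss_tailSum_eq (hY : IsRadialPoisson P (2 * lam) (expMeasure mu) Y G) (hlam : 0 < lam)
    (hmu : 0 < mu) (hm : 0 < m) :
    ∀ᵐ ω ∂P, ∀ s, tailWeight Y G (pathLoss Pd alpha s) (lastCoord m (dists Y m ω)) ω
      = expNeg (ENNReal.ofReal s * interference Pd alpha Y G m ω) := by
  have := isProbabilityMeasure_expMeasure hmu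
  filter_upwards [hY.ae_isSimpleConfig (by positivity)] with ω hω s
  rw [tailWeight, interference_eq_tsum, ← ENNReal.tsum_mul_left]
  congr 1
  refine tsum_congr fun i => ?_
  have hiff : i ∈ (cooperating Y m ω)ᶜ ↔ |Y i ω| ∈ Ioi (lastCoord m (dists Y m ω)) := by
    rw [lastCoord_dists, mem_Ioi, ← hω.le_encard_lt_iff hm, ← not_lt]
    rfl
  by_cases hi : i ∈ (cooperating Y m ω)ᶜ
  · rw [indicator_of_mem hi, indicator_of_mem (hiff.1 hi)]
    rfl
  · rw [indicator_of_notMem hi, indicator_of_notMem (fun h => hi (hiff.2 h)), mul_zero]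

theorem setLIntegral_expNeg_interference
    (hY : IsRadialPoisson P (2 * lam) (expMeasure mu) Y G) (hlam : 0 < lam) (hmu : 0 < mu)
    (hPd : 0 < Pd) (halpha : 1 < alpha) (hm : 0 < m) {s : ℝ} (hs : 0 ≤ s) {A : Set (Fin m → ℝ)}
    (hA : MeasurableSet A) :
    ∫⁻ ω in dists Y m ⁻¹' A, expNeg (ENNReal.ofReal s * interference Pd alpha Y G m ω) ∂P
      = ∫⁻ x in A, ENNReal.ofReal (zeta lam mu Pd alpha s (lastCoord m x)) ∂distLaw lam m := by
  have := isProbabilityMeasure_expMeasure hmu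
  have hlast := measurable_lastCoord m
  have h1 := hY.hasTailLaw (by positivity) m _ (measurable_pathLoss Pd alpha s) A hA
  have h2 : ∀ᵐ ω ∂P, tailWeight Y G (pathLoss Pd alpha s) (lastCoord m (dists Y m ω)) ω
      = expNeg (ENNReal.ofReal s * interference Pd alpha Y G m ω) :=
    (hY.ae_pathLoss_tailSum_eq hlam hmu hm).mono fun ω hω => hω s
  rw [lintegral_congr_ae (ae_restrict_of_ae h2)] at h1
  have hf : Measurable fun x : Fin m → ℝ => ENNReal.ofReal (jointDensity lam m (lastCoord m x)) :=
    ((measurable_jointDensity lam m).comp hlast).ennreal_ofReal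
  have hz : Measurable fun x : Fin m → ℝ =>
      ENNReal.ofReal (zeta lam mu Pd alpha s (lastCoord m x)) :=
    (measurable_zeta.comp (measurable_const.prodMk hlast)).ennreal_ofReal
  rw [h1, distLaw, setLIntegral_withDensity_eq_setLIntegral_mul _ hf hz hA,
    Measure.restrict_restrict hA]
  refine setLIntegral_congr_fun (hA.inter (measurableSet_orderedRegion m)) fun x hx => ?_
  rw [tailLaplace_pathLoss hlam.le hmu hPd halpha hs (lastCoord_pos hm hx.2)]
  rfl

theorem hasLaw_dists (hY : IsRadialPoisson P (2 * lam) (expMeasure mu) Y G) (hlam : 0 < lam)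
    (hmu : 0 < mu) (hm : 0 < m) : HasLaw (dists Y m) (distLaw lam m) P := by
  have hd := measurable_dists hY.measurable_Y m
  refine ⟨hd.aemeasurable, Measure.ext fun A hA => ?_⟩
  -- At `s = 0` the interference disappears, so any admissible power and exponent will do.
  have h := hY.setLIntegral_expNeg_interference (Pd := 1) (alpha := 2) hlam hmu one_pos
    (by norm_num) hm le_rfl hA
  simp only [ENNReal.ofReal_zero, zero_mul, expNeg_zero, zeta_zero hmu, ENNReal.ofReal_one,
    lintegral_const, one_mul, Measure.restrict_apply_univ] at h
  rw [Measure.map_apply hd hA, h]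

lemma isProbabilityMeasure_distLaw (hY : IsRadialPoisson P (2 * lam) (expMeasure mu) Y G)
    (hlam : 0 < lam) (hmu : 0 < mu) (hm : 0 < m) : IsProbabilityMeasure (distLaw lam m) := by
  have hlaw := hY.hasLaw_dists hlam hmu hm
  rw [← hlaw.map_eq]
  exact Measure.isProbabilityMeasure_map hlaw.aemeasurable

lemma distLaw_compProd_condDistrib (hY : IsRadialPoisson P (2 * lam) (expMeasure mu) Y G)
    (hlam : 0 < lam) (hmu : 0 < mu) (hm : 0 < m) :
    distLaw lam m ⊗ₘ
        condDistrib (fun ω => (interference Pd alpha Y G m ω).toReal) (dists Y m) P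
      = P.map fun ω => (dists Y m ω, (interference Pd alpha Y G m ω).toReal) := by
  rw [← (hY.hasLaw_dists hlam hmu hm).map_eq]
  exact compProd_map_condDistrib
    (measurable_interference hY.measurable_Y hY.measurable_G Pd alpha m).ennreal_toReal.aemeasurable

/-- For `s > 0` one has `E exp (-s I) ≤ P (I < ∞)`, and the left side tends to `1` as `s → 0`
because `zeta` is continuous with value `1` at `s = 0`. -/
theorem ae_interference_lt_top (hY : IsRadialPoisson P (2 * lam) (expMeasure mu) Y G)
    (hlam : 0 < lam) (hmu : 0 < mu) (hPd : 0 < Pd) (halpha : 1 < alpha) (hm : 0 < m) :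
    ∀ᵐ ω ∂P, interference Pd alpha Y G m ω < ∞ := by
  have hlast := measurable_lastCoord m
  have hI := measurable_interference hY.measurable_Y hY.measurable_G Pd alpha m
  have := hY.isProbabilityMeasure_distLaw hlam hmu hm
  have hset : MeasurableSet {ω | interference Pd alpha Y G m ω < ∞} := hI measurableSet_Iio
  have hle : ∀ n : ℕ, ∫⁻ x, ENNReal.ofReal (zeta lam mu Pd alpha (1 / ((n : ℝ) + 1))
      (lastCoord m x)) ∂distLaw lam m ≤ P {ω | interference Pd alpha Y G m ω < ∞} := by
    intro n
    have hn : (0 : ℝ) < 1 / ((n : ℝ) + 1) := by positivity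
    have h := hY.setLIntegral_expNeg_interference hlam hmu hPd halpha hm hn.le MeasurableSet.univ
    rw [preimage_univ, Measure.restrict_univ, Measure.restrict_univ] at h
    rw [← h, ← lintegral_indicator_one hset]
    refine lintegral_mono fun ω => ?_
    by_cases hω : interference Pd alpha Y G m ω < ∞
    · rw [indicator_of_mem (show ω ∈ {ω | interference Pd alpha Y G m ω < ∞} from hω)]
      exact expNeg_le_one _
    · rw [not_lt, top_le_iff] at hω
      rw [hω, ENNReal.mul_top (by simpa using hn), expNeg_top]
      exact zero_le
  have hlim : Tendsto (fun n : ℕ => ∫⁻ x, ENNReal.ofReal (zeta lam mu Pd alpha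
      (1 / ((n : ℝ) + 1)) (lastCoord m x)) ∂distLaw lam m) atTop (𝓝 (∫⁻ _, 1 ∂distLaw lam m)) := by
    refine tendsto_lintegral_of_dominated_convergence' (fun _ => 1)
      (fun n => (measurable_zeta.comp
        (measurable_const.prodMk hlast)).ennreal_ofReal.aemeasurable) ?_ (by simp) ?_
    · intro n
      filter_upwards [ae_distLaw_mem lam m] with x hx
      rw [← ENNReal.ofReal_one]
      exact ENNReal.ofReal_le_ofReal
        (zeta_le_one hlam.le hmu hPd (by positivity) (lastCoord_pos hm hx))
    · filter_upwards [ae_distLaw_mem lam m] with x hx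
      have hc := (continuousOn_zeta (lam := lam) hmu hPd halpha (lastCoord_pos hm hx)) 0
        self_mem_Ici
      have h0 : Tendsto (fun n : ℕ => 1 / ((n : ℝ) + 1)) atTop (𝓝[Ici 0] 0) :=
        tendsto_nhdsWithin_iff.2 ⟨tendsto_one_div_add_atTop_nhds_zero_nat,
          Eventually.of_forall fun n => mem_Ici.2 (by positivity)⟩
      have := ENNReal.tendsto_ofReal (hc.tendsto.comp h0)
      rw [zeta_zero hmu, ENNReal.ofReal_one] at this
      exact this
  have hone : P {ω | interference Pd alpha Y G m ω < ∞} = 1 := by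
    refine le_antisymm prob_le_one ?_
    have := le_of_tendsto' hlim hle
    simpa using this
  exact (prob_compl_eq_zero_iff hset).2 hone

/-- For a fixed `s`, both sides have the same integral over every measurable set of distance
vectors. The exceptional null set may depend on `s`. -/
theorem ae_lintegral_condDistrib (hY : IsRadialPoisson P (2 * lam) (expMeasure mu) Y G)
    (hlam : 0 < lam) (hmu : 0 < mu) (hPd : 0 < Pd) (halpha : 1 < alpha) (hm : 0 < m) {s : ℝ}
    (hs : 0 ≤ s) :
    ∀ᵐ x ∂distLaw lam m, ∫⁻ u, ENNReal.ofReal (Real.exp (-(s * u)))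
        ∂(condDistrib (fun ω => (interference Pd alpha Y G m ω).toReal) (dists Y m) P x)
      = ENNReal.ofReal (zeta lam mu Pd alpha s (lastCoord m x)) := by
  have hlast := measurable_lastCoord m
  have hd := measurable_dists hY.measurable_Y m
  have hI := (measurable_interference hY.measurable_Y hY.measurable_G Pd alpha m).ennreal_toReal
  have := hY.isProbabilityMeasure_distLaw hlam hmu hm
  have hexp : Measurable fun u : ℝ => ENNReal.ofReal (Real.exp (-(s * u))) := by fun_prop
  refine ae_eq_of_forall_setLIntegral_eq_of_sigmaFinite hexp.lintegral_kernel
    (measurable_zeta.comp (measurable_const.prodMk hlast)).ennreal_ofReal fun A hA _ => ?_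
  have hcomp := hY.distLaw_compProd_condDistrib (Pd := Pd) (alpha := alpha) hlam hmu hm
  have h1 := Measure.setLIntegral_compProd (μ := distLaw lam m)
    (κ := condDistrib (fun ω => (interference Pd alpha Y G m ω).toReal) (dists Y m) P)
    (f := fun p => ENNReal.ofReal (Real.exp (-(s * p.2)))) (hexp.comp measurable_snd) hA
    MeasurableSet.univ
  have hexp2 : Measurable fun p : (Fin m → ℝ) × ℝ => ENNReal.ofReal (Real.exp (-(s * p.2))) :=
    hexp.comp measurable_snd
  rw [hcomp, setLIntegral_map (hA.prod MeasurableSet.univ) hexp2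
    (hd.prodMk hI)] at h1
  simp only [Measure.restrict_univ] at h1
  rw [← h1, ← hY.setLIntegral_expNeg_interference hlam hmu hPd halpha hm hs hA]
  have hpre : (fun ω => (dists Y m ω, (interference Pd alpha Y G m ω).toReal)) ⁻¹' A ×ˢ univ
      = dists Y m ⁻¹' A := by
    ext ω
    simp
  rw [hpre]
  refine lintegral_congr_ae (ae_restrict_of_ae ?_)
  filter_upwards [hY.ae_interference_lt_top hlam hmu hPd halpha hm] with ω hω
  rw [← expNeg_ofReal (mul_nonneg hs ENNReal.toReal_nonneg), ENNReal.ofReal_mul hs,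
    ENNReal.ofReal_toReal hω.ne]

theorem ae_condDistrib_nonneg (hY : IsRadialPoisson P (2 * lam) (expMeasure mu) Y G)
    (hlam : 0 < lam) (hmu : 0 < mu) (hm : 0 < m) :
    ∀ᵐ x ∂distLaw lam m, ∀ᵐ u
      ∂(condDistrib (fun ω => (interference Pd alpha Y G m ω).toReal) (dists Y m) P x), 0 ≤ u := by
  have hd := measurable_dists hY.measurable_Y m
  have hI := (measurable_interference hY.measurable_Y hY.measurable_G Pd alpha m).ennreal_toReal
  have := hY.isProbabilityMeasure_distLaw hlam hmu hm
  have hcomp := hY.distLaw_compProd_condDistrib (Pd := Pd) (alpha := alpha) hlam hmu hm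
  refine Measure.ae_ae_of_ae_compProd (p := fun q : (Fin m → ℝ) × ℝ => 0 ≤ q.2) ?_
  rw [hcomp, ae_map_iff (hd.prodMk hI).aemeasurable
    (measurableSet_le measurable_const measurable_snd)]
  exact ae_of_all _ fun ω => ENNReal.toReal_nonneg

theorem ae_integral_condDistrib (hY : IsRadialPoisson P (2 * lam) (expMeasure mu) Y G)
    (hlam : 0 < lam) (hmu : 0 < mu) (hPd : 0 < Pd) (halpha : 1 < alpha) (hm : 0 < m) :
    ∀ᵐ x ∂distLaw lam m, ∀ s : ℝ, 0 ≤ s → ∫ u, Real.exp (-(s * u))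
        ∂(condDistrib (fun ω => (interference Pd alpha Y G m ω).toReal) (dists Y m) P x)
      = zeta lam mu Pd alpha s (lastCoord m x) := by
  have hrat : ∀ q : ℚ, ∀ᵐ x ∂distLaw lam m, 0 ≤ (q : ℝ) →
      ∫⁻ u, ENNReal.ofReal (Real.exp (-((q : ℝ) * u)))
        ∂(condDistrib (fun ω => (interference Pd alpha Y G m ω).toReal) (dists Y m) P x)
      = ENNReal.ofReal (zeta lam mu Pd alpha q (lastCoord m x)) := by
    intro q
    by_cases hq : 0 ≤ (q : ℝ)
    · filter_upwards [hY.ae_lintegral_condDistrib hlam hmu hPd halpha hm hq] with x hx _ using hx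
    · exact ae_of_all _ fun x h => absurd h hq
  filter_upwards [ae_all_iff.2 hrat, hY.ae_condDistrib_nonneg hlam hmu hm,
    ae_distLaw_mem lam m] with x hx hnn hord
  set κ := condDistrib (fun ω => (interference Pd alpha Y G m ω).toReal) (dists Y m) P x
  have hcont : ContinuousOn (fun s => ∫ u, Real.exp (-(s * u)) ∂κ) (Ici 0) := by
    intro s _
    refine continuousWithinAt_of_dominated (bound := fun _ => 1)
      (Eventually.of_forall fun s' => by fun_prop) ?_ (integrable_const _)
      (ae_of_all _ fun u => by fun_prop)
    filter_upwards [self_mem_nhdsWithin] with s' hs'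
    filter_upwards [hnn] with u hu
    rw [Real.norm_of_nonneg (Real.exp_pos _).le]
    exact Real.exp_le_one_iff.2 (neg_nonpos.2 (mul_nonneg hs' hu))
  -- Positive rationals are dense in `[0, ∞)`, and both sides are continuous there, so countably
  -- many null sets suffice.
  have hdense : Ici (0 : ℝ) ⊆ closure (Ioi 0 ∩ range ((↑) : ℚ → ℝ)) := by
    rw [← closure_Ioi]
    exact closure_minimal (Rat.denseRange_cast.open_subset_closure_inter isOpen_Ioi)
      isClosed_closure
  have heq : EqOn (fun s => ∫ u, Real.exp (-(s * u)) ∂κ)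
      (fun s => zeta lam mu Pd alpha s (lastCoord m x)) (Ioi 0 ∩ range ((↑) : ℚ → ℝ)) := by
    rintro _ ⟨hq, q, rfl⟩
    have h := hx q (le_of_lt hq)
    simp only
    rw [integral_eq_lintegral_of_nonneg_ae (ae_of_all _ fun u => (Real.exp_pos _).le)
      (by fun_prop), h, ENNReal.toReal_ofReal (zeta_nonneg _ _)]
  intro s hs
  exact (heq.of_subset_closure hcont (continuousOn_zeta hmu hPd halpha (lastCoord_pos hm hord))
    (inter_subset_left.trans Ioi_subset_Ici_self) hdense) hs

end IsRadialPoisson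

/-! ### Coverage -/

section Coverage

variable {mu t Pd alpha sig2 : ℝ} {m : ℕ}

lemma sum_pathGain_pos (hPd : 0 < Pd) (hm : 0 < m) {x : Fin m → ℝ} (hx : x ∈ orderedRegion m) :
    0 < ∑ k, Pd * x k ^ (-alpha) := by
  have : Nonempty (Fin m) := ⟨⟨0, hm⟩⟩
  exact Finset.sum_pos (fun k _ => mul_pos hPd (Real.rpow_pos_of_pos (hx.1 k) _))
    Finset.univ_nonempty

lemma jArg_nonneg (hmu : 0 < mu) (ht : 0 ≤ t) (hPd : 0 < Pd) (hm : 0 < m) {x : Fin m → ℝ}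
    (hx : x ∈ orderedRegion m) : 0 ≤ jArg mu t Pd alpha x :=
  div_nonneg (mul_nonneg hmu.le ht) (sum_pathGain_pos hPd hm hx).le

lemma measurable_jArg : Measurable (jArg mu t Pd alpha : (Fin m → ℝ) → ℝ) := by
  unfold jArg
  fun_prop

lemma lt_sinr_iff {Ω : Type*} {Y G : ℕ → Ω → ℝ} {g : Ω → ℝ} {ω : Ω} (ht : 0 ≤ t) (hPd : 0 < Pd)
    (hm : 0 < m) (hsig2 : 0 ≤ sig2) (hI : interference Pd alpha Y G m ω < ∞)
    (hx : dists Y m ω ∈ orderedRegion m) :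
    ENNReal.ofReal t < sinr Pd alpha sig2 Y G g m ω ↔
      t * ((interference Pd alpha Y G m ω).toReal + sig2) / ∑ k, Pd * dists Y m ω k ^ (-alpha)
        < g ω := by
  set K := ∑ k, Pd * dists Y m ω k ^ (-alpha) with hK
  set b := (interference Pd alpha Y G m ω).toReal + sig2 with hb
  have hK0 : 0 < K := sum_pathGain_pos hPd hm hx
  have hb0 : 0 ≤ b := add_nonneg ENNReal.toReal_nonneg hsig2
  have hsig : ∑ k : Fin m, Pd * g ω * dists Y m ω k ^ (-alpha) = g ω * K := by
    rw [hK, Finset.mul_sum]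
    exact Finset.sum_congr rfl fun k _ => by ring
  have hden : interference Pd alpha Y G m ω + ENNReal.ofReal sig2 = ENNReal.ofReal b := by
    rw [hb, ENNReal.ofReal_add ENNReal.toReal_nonneg hsig2, ENNReal.ofReal_toReal hI.ne]
  rw [sinr, hsig, hden, div_lt_iff₀ hK0]
  -- Two degenerate cases obey the extended conventions: a nonpositive gain gives SINR `0`, and a
  -- positive gain with zero denominator gives SINR `∞`.
  rcases le_or_gt (g ω) 0 with hg | hg
  · have h1 : g ω * K ≤ 0 := mul_nonpos_of_nonpos_of_nonneg hg hK0.le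
    rw [ENNReal.ofReal_of_nonpos h1, ENNReal.zero_div]
    exact iff_of_false not_lt_zero (not_lt.2 (h1.trans (mul_nonneg ht hb0)))
  · have h1 : 0 < g ω * K := mul_pos hg hK0
    rcases hb0.eq_or_lt with hb1 | hb1
    · rw [← hb1, ENNReal.ofReal_zero, ENNReal.div_zero (by simpa using h1), mul_zero]
      exact iff_of_true ENNReal.ofReal_lt_top h1
    · rw [← ENNReal.ofReal_div_of_pos hb1, ENNReal.ofReal_lt_ofReal_iff (div_pos h1 hb1),
        lt_div_iff₀ hb1]

end Coverage

/-- An independent exponential variable exceeds a nonnegative function of `Z` with the expected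
conditional probability. -/
lemma measure_lt_exponential {Ω α : Type*} [MeasurableSpace Ω] [MeasurableSpace α] {P : Measure Ω}
    [IsProbabilityMeasure P] {mu : ℝ} (hmu : 0 < mu) {Z : Ω → α} {g : Ω → ℝ} (hZ : Measurable Z)
    (hg : Measurable g) (hlaw : P.map g = expMeasure mu) (hind : IndepFun Z g P) {a : α → ℝ}
    (ha : Measurable a) (ha0 : ∀ᵐ ω ∂P, 0 ≤ a (Z ω)) :
    P {ω | a (Z ω) < g ω} = ∫⁻ ω, ENNReal.ofReal (Real.exp (-(mu * a (Z ω)))) ∂P := by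
  have := isProbabilityMeasure_expMeasure hmu
  have hset : MeasurableSet {q : α × ℝ | a q.1 < q.2} :=
    measurableSet_lt (ha.comp measurable_fst) measurable_snd
  have h1 : P {ω | a (Z ω) < g ω} = P.map (fun ω => (Z ω, g ω)) {q : α × ℝ | a q.1 < q.2} := by
    rw [Measure.map_apply (hZ.prodMk hg) hset]
    rfl
  rw [h1, (indepFun_iff_map_prod_eq_prod_map_map hZ.aemeasurable hg.aemeasurable).1 hind, hlaw,
    Measure.prod_apply hset, lintegral_map (measurable_measure_prodMk_left hset) hZ]
  refine lintegral_congr_ae ?_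
  filter_upwards [ha0] with ω hω
  rw [← expMeasure_Ioi hmu hω]
  rfl

lemma IsDownlink.indepFun_gain {Ω : Type*} [MeasurableSpace Ω] {P : Measure Ω}
    [IsProbabilityMeasure P] {lamd mu w : ℝ} {v : ℝ≥0} {X chi G : ℕ → Ω → ℝ} {g : Ω → ℝ}
    (hnet : IsDownlink P lamd mu w v X chi G g) (Pd alpha : ℝ) (m : ℕ) :
    IndepFun (fun ω => (dists (displaced alpha X chi) m ω,
      (interference Pd alpha (displaced alpha X chi) G m ω).toReal)) g P := by
  have hXs : Measurable fun ω i => X i ω := measurable_pi_lambda _ hnet.poisson.measurable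
  have hcs : Measurable fun ω i => chi i ω := measurable_pi_lambda _ hnet.chi_measurable
  have hGs : Measurable fun ω i => G i ω := measurable_pi_lambda _ hnet.G_measurable
  have h1 : IndepFun (fun ω => ((fun i => chi i ω), (fun i => G i ω))) g P :=
    indepFun_prodMk_left hcs hGs hnet.g_measurable hnet.indep_chi hnet.indep_G
  have h2 : IndepFun (fun ω i => X i ω)
      (fun ω => (((fun i => chi i ω), (fun i => G i ω)), g ω)) P :=
    hnet.indep_X.comp measurable_id MeasurableEquiv.prodAssoc.symm.measurable
  have h3 := indepFun_prodMk_left hXs (hcs.prodMk hGs) hnet.g_measurable h2 h1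
  -- The coordinate processes on sequence space exhibit the distances and the interference as one
  -- measurable function of `(X, chi, G)`, a triple independent of `g`.
  let X' : ℕ → (ℕ → ℝ) × (ℕ → ℝ) × (ℕ → ℝ) → ℝ := fun i p => p.1 i
  let chi' : ℕ → (ℕ → ℝ) × (ℕ → ℝ) × (ℕ → ℝ) → ℝ := fun i p => p.2.1 i
  let G' : ℕ → (ℕ → ℝ) × (ℕ → ℝ) × (ℕ → ℝ) → ℝ := fun i p => p.2.2 i
  have hX' : ∀ i, Measurable (X' i) := fun i => (measurable_pi_apply i).comp measurable_fst
  have hchi' : ∀ i, Measurable (chi' i) := fun i =>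
    (measurable_pi_apply i).comp (measurable_fst.comp measurable_snd)
  have hG' : ∀ i, Measurable (G' i) := fun i =>
    (measurable_pi_apply i).comp (measurable_snd.comp measurable_snd)
  have hY' := measurable_displaced hX' hchi' alpha
  exact h3.comp (φ := fun p => (dists (displaced alpha X' chi') m p,
      (interference Pd alpha (displaced alpha X' chi') G' m p).toReal))
    ((measurable_dists hY' m).prodMk (measurable_interference hY' hG' Pd alpha m).ennreal_toReal)
    measurable_id

theorem IsDownlink.measure_lt_sinr {Ω : Type*} [MeasurableSpace Ω] {P : Measure Ω}
    [IsProbabilityMeasure P] {lamd mu w Pd alpha sig2 t : ℝ} {v : ℝ≥0} {X chi G : ℕ → Ω → ℝ}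
    {g : Ω → ℝ} {m : ℕ} (hnet : IsDownlink P lamd mu w v X chi G g) (hlamd : 0 < lamd)
    (hmu : 0 < mu) (hPd : 0 < Pd) (halpha : 1 < alpha) (hsig2 : 0 ≤ sig2) (ht : 0 ≤ t)
    (hm : 0 < m) :
    P {ω | ENNReal.ofReal t < sinr Pd alpha sig2 (displaced alpha X chi) G g m ω}
      = ∫⁻ x in orderedRegion m, ENNReal.ofReal
          (zeta (lamD lamd alpha w v) mu Pd alpha (jArg mu t Pd alpha x) (lastCoord m x)
            * Real.exp (-(jArg mu t Pd alpha x * sig2))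
            * jointDensity (lamD lamd alpha w v) m (lastCoord m x)) := by
  set Y := displaced alpha X chi
  set lam := lamD lamd alpha w v
  have hlam : 0 < lam := lamD_pos hlamd
  have hY : IsRadialPoisson P (2 * lam) (expMeasure mu) Y G :=
    hnet.isRadialPoisson hlamd hmu alpha
  have := hY.isProbabilityMeasure_distLaw hlam hmu hm
  have hd := measurable_dists hY.measurable_Y m
  have hI := (measurable_interference hY.measurable_Y hY.measurable_G Pd alpha m).ennreal_toReal
  have hlaw := hY.hasLaw_dists hlam hmu hm
  have hmem : ∀ᵐ ω ∂P, dists Y m ω ∈ orderedRegion m := by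
    have h := ae_distLaw_mem lam m
    rw [← hlaw.map_eq] at h
    exact ae_of_ae_map hd.aemeasurable h
  let a : (Fin m → ℝ) × ℝ → ℝ := fun q => t * (q.2 + sig2) / ∑ k, Pd * q.1 k ^ (-alpha)
  have ha : Measurable a := by
    simp only [a]
    fun_prop
  have e1 : P {ω | ENNReal.ofReal t < sinr Pd alpha sig2 Y G g m ω}
      = P {ω | a (dists Y m ω, (interference Pd alpha Y G m ω).toReal) < g ω} := by
    refine measure_congr ?_
    filter_upwards [hmem, hY.ae_interference_lt_top hlam hmu hPd halpha hm] with ω h1 h2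
    exact propext (lt_sinr_iff ht hPd hm hsig2 h2 h1)
  have ha0 : ∀ᵐ ω ∂P, 0 ≤ a (dists Y m ω, (interference Pd alpha Y G m ω).toReal) := by
    filter_upwards [hmem] with ω h1
    exact div_nonneg (mul_nonneg ht (add_nonneg ENNReal.toReal_nonneg hsig2))
      (sum_pathGain_pos hPd hm h1).le
  -- The exponent splits as `j u + j sig2`, so the conditional mean is the Laplace transform at `j`
  -- times the noise factor.
  have hja : ∀ x u, mu * a (x, u) = jArg mu t Pd alpha x * u + jArg mu t Pd alpha x * sig2 := by
    intro x u
    simp only [a, jArg]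
    ring
  have hH : Measurable fun q : (Fin m → ℝ) × ℝ => ENNReal.ofReal (Real.exp (-(mu * a q))) :=
    (Real.measurable_exp.comp (ha.const_mul mu).neg).ennreal_ofReal
  have e2 := lintegral_map (μ := P) hH (hd.prodMk hI)
  rw [← hY.distLaw_compProd_condDistrib (Pd := Pd) (alpha := alpha) hlam hmu hm,
    Measure.lintegral_compProd hH] at e2
  rw [e1, measure_lt_exponential hmu (hd.prodMk hI) hnet.g_measurable hnet.g_law.map_eq
    (hnet.indepFun_gain Pd alpha m) ha ha0, ← e2]
  have e3 : ∀ᵐ x ∂distLaw lam m, ∫⁻ u, ENNReal.ofReal (Real.exp (-(mu * a (x, u))))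
        ∂(condDistrib (fun ω => (interference Pd alpha Y G m ω).toReal) (dists Y m) P x)
      = ENNReal.ofReal (zeta lam mu Pd alpha (jArg mu t Pd alpha x) (lastCoord m x)
          * Real.exp (-(jArg mu t Pd alpha x * sig2))) := by
    filter_upwards [hY.ae_integral_condDistrib hlam hmu hPd halpha hm,
      hY.ae_condDistrib_nonneg (Pd := Pd) (alpha := alpha) hlam hmu hm,
      ae_distLaw_mem lam m] with x hx hnn hord
    have hj := jArg_nonneg (alpha := alpha) hmu ht hPd hm hord
    rw [← hx _ hj, ← integral_mul_const]
    simp_rw [hja, neg_add, Real.exp_add]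
    refine (ofReal_integral_eq_lintegral_ofReal ?_ (ae_of_all _ fun u => by positivity)).symm
    refine Integrable.mul_const (Integrable.mono' (integrable_const 1) (by fun_prop) ?_) _
    filter_upwards [hnn] with u hu
    rw [Real.norm_of_nonneg (Real.exp_pos _).le]
    exact Real.exp_le_one_iff.2 (neg_nonpos.2 (mul_nonneg hj hu))
  have hf : Measurable fun x : Fin m → ℝ => ENNReal.ofReal (jointDensity lam m (lastCoord m x)) :=
    ((measurable_jointDensity lam m).comp (measurable_lastCoord m)).ennreal_ofReal
  have hz : Measurable fun x : Fin m → ℝ => ENNReal.ofReal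
      (zeta lam mu Pd alpha (jArg mu t Pd alpha x) (lastCoord m x)
        * Real.exp (-(jArg mu t Pd alpha x * sig2))) :=
    ((measurable_zeta.comp (measurable_jArg.prodMk (measurable_lastCoord m))).mul
      (Real.measurable_exp.comp (measurable_jArg.mul_const sig2).neg)).ennreal_ofReal
  rw [lintegral_congr_ae e3, distLaw, lintegral_withDensity_eq_lintegral_mul _ hf hz]
  refine lintegral_congr fun x => ?_
  rw [Pi.mul_apply, mul_comm, ← ENNReal.ofReal_mul (mul_nonneg (zeta_nonneg _ _) (Real.exp_pos _).le)]

end CV2X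

theorem theorem1 {Ω : Type*} [MeasurableSpace Ω] (P : Measure Ω) [IsProbabilityMeasure P]
    (m : ℕ) (hm : 0 < m)
    (lamd mu Pd alpha sig2 w t : ℝ) (v : ℝ≥0)
    (hlamd : 0 < lamd) (hmu : 0 < mu) (hPd : 0 < Pd) (halpha : 2 < alpha)
    (hsig2 : 0 ≤ sig2) (ht : 0 ≤ t)
    (X chi G : ℕ → Ω → ℝ) (g : Ω → ℝ)
    (hnet : CV2X.IsDownlink P lamd mu w v X chi G g) :
    let Y : ℕ → Ω → ℝ := CV2X.displaced alpha X chi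
    let lam : ℝ := CV2X.lamD lamd alpha w v
    let I : Ω → ℝ≥0∞ := CV2X.interference Pd alpha Y G m
    let last : Fin m := ⟨m - 1, Nat.sub_one_lt_of_lt hm⟩
    let f : (Fin m → ℝ) → ℝ := fun x => CV2X.jointDensity lam m (x last)
    -- `f` on the ordered region is the joint density of the `m` smallest distances
    HasLaw (CV2X.dists Y m)
      ((volume.restrict (CV2X.orderedRegion m)).withDensity (fun x => ENNReal.ofReal (f x))) P ∧
    -- the interference is a finite random variable, and its Laplace transform given the
    -- distances `x_1, …, x_m` is `zeta`
    AEMeasurable I P ∧ (∀ᵐ ω ∂P, I ω < ∞) ∧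
    (∀ᵐ x ∂(volume.restrict (CV2X.orderedRegion m)), ∀ s : ℝ, 0 ≤ s →
      ∫ u, Real.exp (-(s * u))
          ∂(condDistrib (fun ω => (I ω).toReal) (CV2X.dists Y m) P x)
        = CV2X.zeta lam mu Pd alpha s (x last)) ∧
    -- the coverage probability
    IntegrableOn (fun x => CV2X.zeta lam mu Pd alpha (CV2X.jArg mu t Pd alpha x) (x last)
        * Real.exp (-(CV2X.jArg mu t Pd alpha x * sig2)) * f x) (CV2X.orderedRegion m) ∧
    P.real {ω | ENNReal.ofReal t < CV2X.sinr Pd alpha sig2 Y G g m ω}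
      = ∫ x in CV2X.orderedRegion m,
          CV2X.zeta lam mu Pd alpha (CV2X.jArg mu t Pd alpha x) (x last)
            * Real.exp (-(CV2X.jArg mu t Pd alpha x * sig2)) * f x := by
  intro Y lam I last f
  have halpha' : 1 < alpha := by linarith
  have hlam : 0 < lam := CV2X.lamD_pos hlamd
  have hY : CV2X.IsRadialPoisson P (2 * lam) (expMeasure mu) Y G :=
    hnet.isRadialPoisson hlamd hmu alpha
  have hlast : ∀ x : Fin m → ℝ, x last = CV2X.lastCoord m x := by
    obtain ⟨k, rfl⟩ : ∃ k, m = k + 1 := ⟨m - 1, by omega⟩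
    exact fun x => rfl
  have hfm : Measurable f :=
    (CV2X.measurable_jointDensity lam m).comp (measurable_pi_apply last)
  have hf0 : ∀ x, 0 < f x := fun x => CV2X.jointDensity_pos hlam m _
  have hdist : (volume.restrict (CV2X.orderedRegion m)).withDensity (fun x => ENNReal.ofReal (f x))
      = CV2X.distLaw lam m := by
    have h : f = fun x => CV2X.jointDensity lam m (CV2X.lastCoord m x) :=
      funext fun x => congrArg (CV2X.jointDensity lam m) (hlast x)
    rw [h, CV2X.distLaw]
  set H : (Fin m → ℝ) → ℝ := fun x =>
    CV2X.zeta lam mu Pd alpha (CV2X.jArg mu t Pd alpha x) (x last)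
      * Real.exp (-(CV2X.jArg mu t Pd alpha x * sig2)) * f x with hH
  have hH0 : ∀ x, 0 ≤ H x := fun x =>
    mul_nonneg (mul_nonneg (CV2X.zeta_nonneg _ _) (Real.exp_pos _).le) (hf0 x).le
  have hHm : Measurable H :=
    ((CV2X.measurable_zeta.comp (CV2X.measurable_jArg.prodMk (measurable_pi_apply last))).mul
      (Real.measurable_exp.comp (CV2X.measurable_jArg.mul_const sig2).neg)).mul hfm
  have hcov : P {ω | ENNReal.ofReal t < CV2X.sinr Pd alpha sig2 Y G g m ω}
      = ∫⁻ x in CV2X.orderedRegion m, ENNReal.ofReal (H x) := by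
    have h := hnet.measure_lt_sinr hlamd hmu hPd halpha' hsig2 ht hm
    simp_rw [← hlast] at h
    exact h
  -- The integrand is nonnegative and its lower integral is a probability, hence finite.
  have hint : IntegrableOn H (CV2X.orderedRegion m) := by
    refine ⟨hHm.aestronglyMeasurable, ?_⟩
    rw [hasFiniteIntegral_iff_ofReal (Filter.Eventually.of_forall hH0), ← hcov]
    exact measure_lt_top _ _
  refine ⟨?_, ?_, ?_, ?_, hint, ?_⟩
  · rw [hdist]
    exact hY.hasLaw_dists hlam hmu hm
  · exact (CV2X.measurable_interference hY.measurable_Y hY.measurable_G Pd alpha m).aemeasurable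
  · exact hY.ae_interference_lt_top hlam hmu hPd halpha' hm
  · have h := hY.ae_integral_condDistrib hlam hmu hPd halpha' hm
    -- The density is strictly positive, so a null set for the law of the distances is Lebesgue-null
    -- in the ordered region.
    rw [← hdist, ae_withDensity_iff hfm.ennreal_ofReal] at h
    filter_upwards [h] with x hx
    rw [hlast x]
    exact hx (ENNReal.ofReal_pos.2 (hf0 x)).ne'
  · rw [measureReal_def, hcov, ← ofReal_integral_eq_lintegral_ofReal hint
      (Filter.Eventually.of_forall hH0), ENNReal.toReal_ofReal (integral_nonneg hH0)]
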